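/- Let $H=0.1$, $T=1$, let $W$ be a standard one-dimensional Brownian motion on a probability space, let $$G(t)=\frac{t^{H-1/2}}{\Gamma(H+1/2)},\qquad c_H=\frac1{\Gamma(H+1/2)\,\Gamma(1/2-H)},\qquad w(x)=c_Hx^{-H-1/2},$$ and let $X_t=\int_0^tG(t-s)\,dW_s$ be the (modified) Riemann–Liouville fractional Brownian motion. Let $\alpha=1.06418$ and $A=\big(\frac1H+\frac1{3/2-H}\big)^{1/2}$. Let $N,m,n\ge1$ be integers with $$|m-0.1306\sqrt N|<1,\qquad |n-N/m|<1$$ (in particular every factorization $N=nm$ with $|m-0.1306\sqrt N|<1$ is allowed), and put $$\xi_0=4.3679\,N^{0.1135}\exp\Big(-\frac{\alpha}{(3/2-H)A}\sqrt N\Big),\qquad \xi_n=0.1421\,N^{-1.5889}e^{3.2511\sqrt N},\qquad \xi_i=\xi_0\Big(\frac{\xi_n}{\xi_0}\Big)^{i/n}\quad(0\le i\le n),$$ where $\frac{\alpha}{(3/2-H)A}\approx0.2322$. For each $i=0,\dots,n-1$ take the $m$ nodes and weights of the Gaussian quadrature rule of level $m$ on $[\xi_i,\xi_{i+1}]$ with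 respect to the weight function $w$, i.e. the $m$-point rule that integrates all polynomials of degree at most $2m-1$ exactly against $w$. Let $(x_k)_{k=1}^{nm}$ and $(w_k)_{k=1}^{nm}$ be all these nodes and weights, and add the node $x_0=0$ with weight $w_0=c_H\int_0^{\xi_0}x^{-H-1/2}\,dx=\frac{c_H}{1/2-H}\xi_0^{1/2-H}$. Let $$\hat G(t)=\sum_{k=0}^{nm}w_ke^{-x_kt},\qquad \hat X_t=\int_0^t\hat G(t-s)\,dW_s$$ be the associated Markovian approximation. Then $X_T-\hat X_T$ is square integrable, $$\mathbb E|X_T-\hat X_T|^2\le\int_0^T|G(t)-\hat G(t)|^2\,dt$$ (i.e. the stability constant is $C=1$), and $$\mathbb E|X_T-\hat X_T|^2\le33.6483\,N^{0.3178}\,e^{-0.6502\sqrt N}.$$ -/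

import Mathlib

open MeasureTheory ProbabilityTheory Filter Topology
open scoped NNReal ENNReal

namespace MarkovApprox

/-! ### The Wiener integral of a deterministic square-integrable function -/

/-- A real step function on `(0, T]`, given as a finite linear combination
`∑ i, coeff i • 1_{(left i, right i]}` of indicators of subintervals of `(0, T]`. -/
structure StepFun (T : ℝ≥0) where
  size : ℕ
  coeff : Fin size → ℝ
  left : Fin size → ℝ≥0
  right : Fin size → ℝ≥0
  left_le_right : ∀ i, left i ≤ right i
  right_le : ∀ i, right i ≤ T

/-- The underlying function of a step function. -/
noncomputable def StepFun.toFun {T : ℝ≥0} (φ : StepFun T) (s : ℝ) : ℝ :=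
  ∑ i, (Set.Ioc (φ.left i : ℝ) (φ.right i : ℝ)).indicator (fun _ => φ.coeff i) s

/-- The elementary stochastic integral `∑ i, coeff i * (W_{right i} - W_{left i})`. -/
noncomputable def StepFun.integral {Ω : Type*} {T : ℝ≥0} (φ : StepFun T)
    (W : ℝ≥0 → Ω → ℝ) (ω : Ω) : ℝ :=
  ∑ i, φ.coeff i * (W (φ.right i) ω - W (φ.left i) ω)

/-- `I` is (a version of) the Wiener integral `∫_0^T f(s) dW_s` of `f ∈ L²(0, T)`: the
`L²(P)`-limit of the elementary integrals of step functions converging to `f` in `L²(0, T)`. -/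
structure IsWienerIntegral {Ω : Type*} [MeasurableSpace Ω] (P : Measure Ω) (W : ℝ≥0 → Ω → ℝ)
    (T : ℝ≥0) (f : ℝ → ℝ) (I : Ω → ℝ) : Prop where
  memLp_integrand : MemLp f 2 (volume.restrict (Set.Ioc (0 : ℝ) T))
  memLp : MemLp I 2 P
  exists_approx : ∃ φ : ℕ → StepFun T,
    Tendsto (fun k => eLpNorm (fun s => f s - (φ k).toFun s) 2
      (volume.restrict (Set.Ioc (0 : ℝ) T))) atTop (𝓝 0) ∧
    Tendsto (fun k => eLpNorm (fun ω => I ω - (φ k).integral W ω) 2 P) atTop (𝓝 0)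

/-- `X_t = ∫_0^t K(t - s) dW_s` for every `t ≥ 0`. -/
def IsGaussianVolterra {Ω : Type*} [MeasurableSpace Ω] (P : Measure Ω) (W : ℝ≥0 → Ω → ℝ)
    (K : ℝ → ℝ) (X : ℝ≥0 → Ω → ℝ) : Prop :=
  ∀ t : ℝ≥0, IsWienerIntegral P W t (fun s => K (t - s)) (X t)

/-! ### The fractional kernel and its approximation by Gaussian quadrature -/

/-- The fractional kernel `G(t) = t ^ (H - 1/2) / Γ(H + 1/2)`. -/
noncomputable def fracKernel (H t : ℝ) : ℝ :=
  t ^ (H - 1 / 2) / Real.Gamma (H + 1 / 2)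

/-- The constant `c_H = 1 / (Γ(H + 1/2) Γ(1/2 - H))`. -/
noncomputable def fracConst (H : ℝ) : ℝ :=
  1 / (Real.Gamma (H + 1 / 2) * Real.Gamma (1 / 2 - H))

/-- The weight function `w(x) = c_H x ^ (-H - 1/2)`, whose Laplace transform is `G`. -/
noncomputable def fracWeight (H x : ℝ) : ℝ :=
  fracConst H * x ^ (-H - 1 / 2)

/-- `x` and `v` are the nodes and weights of the Gaussian quadrature rule of level `m` on `[a, b]`
with respect to the weight function `w`: the nodes are `m` distinct points of `[a, b]`, and the
rule is exact for all polynomials of degree at most `2 m - 1`. -/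
structure IsGaussQuadrature (w : ℝ → ℝ) (a b : ℝ) (m : ℕ) (x v : Fin m → ℝ) : Prop where
  injective : Function.Injective x
  mem_Icc : ∀ j, x j ∈ Set.Icc a b
  exact_on : ∀ p : Polynomial ℝ, p.natDegree < 2 * m →
    ∑ j, v j * p.eval (x j) = ∫ y in a..b, p.eval y * w y

/-- The geometrically spaced points `ξ_i = ξ₀ (ξₙ / ξ₀) ^ (i / n)`, `i = 0, …, n`. -/
noncomputable def geomPoint (ξ₀ ξₙ : ℝ) (n i : ℕ) : ℝ :=
  ξ₀ * (ξₙ / ξ₀) ^ ((i : ℝ) / (n : ℝ))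

/-- `x i`, `v i` are the nodes and weights of the Gaussian quadrature rule of level `m` on
`[ξ_i, ξ_{i+1}]` with respect to the fractional weight, for every `i = 0, …, n - 1`. -/
def IsGaussianRule (H ξ₀ ξₙ : ℝ) (m n : ℕ) (x v : Fin n → Fin m → ℝ) : Prop :=
  ∀ i : Fin n, IsGaussQuadrature (fracWeight H)
    (geomPoint ξ₀ ξₙ n i) (geomPoint ξ₀ ξₙ n (i + 1)) m (x i) (v i)

/-- The weight of the node `0`, i.e. `w₀ = c_H ∫_0^{ξ₀} x ^ (-H - 1/2) dx`, in closed form. -/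
noncomputable def zeroWeight (H ξ₀ : ℝ) : ℝ :=
  fracConst H / (1 / 2 - H) * ξ₀ ^ (1 / 2 - H)

/-- The approximating kernel `Ĝ(t) = w₀ e^{-0 t} + ∑ w e^{-x t}`, the sum running over the `n m`
nodes `x` and weights `w` of a Gaussian rule. -/
noncomputable def approxKernel (H ξ₀ : ℝ) {m n : ℕ} (x v : Fin n → Fin m → ℝ) (t : ℝ) : ℝ :=
  zeroWeight H ξ₀ + ∑ i, ∑ j, v i j * Real.exp (-(x i j) * t)

end MarkovApprox

namespace MarkovApprox

/-! The stability bound is the L² contraction of the Wiener integral: the second moment of `X 1 -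
Xhat 1` is at most the squared L²(0,1) norm of G - Ĝ. It remains to bound that norm by 5.8 N^0.1589
e^(-0.3251 √N), since 5.8² = 33.64.

G is the Laplace transform of w, so the kernel error splits at ξ₀ and ξₙ. On [0, ξ₀], 1 - e^(-xt) ≤
xt gives order ξ₀^(3/2-H). Beyond ξₙ, Minkowski's integral inequality gives order ξₙ^(-H). In
between lie the intervals [a, qa] with q = (ξₙ/ξ₀)^(1/n). There the Taylor polynomial of x ↦ e^(-xt)
of degree 2m-1 at the midpoint stays below the function, with a gap of at most M = ((q-1)/2)^(2m)
(at)^(2m)/(2m)! e^(-at). The rule is exact on the polynomial and its weights are nonnegative, so the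
integral and the sum both exceed the same number by an amount in [0, M ∫w]; the local error is at
most M ∫w. The L² norm in t of (at)^(2m)/(2m)! e^(-at) is O(min(1, a^(-1/2))), and w(x) min(1,
x^(-1/2)) is integrable on (0,∞), so summing over the intervals costs a constant times √q, uniformly
in n, ξ₀ and ξₙ (`eLpNorm_fracKernel_sub_approxKernel_le`).

For the numbers put s = √N, Λ = log(ξₙ/ξ₀), u = Λ/n, so q = e^u. The choice of ξ₀ and ξₙ gives the
two truncation errors the rate e^(-0.3251 s). For the quadrature, u ↦ log((e^u-1)/2) is concave, so
a tangent line reduces the claim to an inequality in s and m (`level_exponent_le`), with separate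
tangents for m = 1 and m ≥ 2. The three errors contribute 1.038, 2.738 and 2.024, which add up to
5.8 (`error_constant_le`). -/

lemma min_sub_min_eq_volume_inter {a b c d : ℝ} (hab : a ≤ b) (hcd : c ≤ d) :
    min b d - min b c - (min a d - min a c) = volume.real (Set.Ioc a b ∩ Set.Ioc c d) := by
  rw [Set.Ioc_inter_Ioc, Real.volume_real_Ioc]
  rcases le_total a c with h1 | h1 <;> rcases le_total a d with h2 | h2 <;>
  rcases le_total b c with h3 | h3 <;> rcases le_total b d with h4 | h4 <;>
  simp only [h1, h2, h3, h4, min_eq_left, min_eq_right, sup_of_le_left, sup_of_le_right] <;>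
  (first | rw [max_eq_left (by linarith)] | rw [max_eq_right (by linarith)]) <;> linarith

/-! ### L² contraction of the Wiener integral. -/

section WienerIntegral

variable {Ω : Type*} [MeasurableSpace Ω] {P : Measure Ω} {W : ℝ≥0 → Ω → ℝ}

lemma integral_increment_mul_increment (hW : IsPreBrownianReal W P) {a b c d : ℝ≥0}
    (hab : a ≤ b) (hcd : c ≤ d) :
    ∫ ω, (W b ω - W a ω) * (W d ω - W c ω) ∂P
      = volume.real (Set.Ioc (a : ℝ) b ∩ Set.Ioc (c : ℝ) d) := by
  have : IsProbabilityMeasure P := hW.isGaussianProcess.isProbabilityMeasure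
  have hL : ∀ t, MemLp (W t) 2 P := fun t =>
    (hW.isGaussianProcess.hasGaussianLaw_eval t).memLp_two
  have hm : ∀ t u, ∫ ω, (W t ω - W u ω) ∂P = 0 := fun t u => by
    rw [integral_sub (hW.integrable_eval t) (hW.integrable_eval u), hW.integral_eval,
      hW.integral_eval, sub_zero]
  have key := covariance_eq_sub ((hL b).sub (hL a)) ((hL d).sub (hL c))
  have e1 : ∀ t u : ℝ≥0, P[W t - W u] = 0 := fun t u => hm t u
  rw [e1, e1, mul_zero, sub_zero] at key
  have hprod : ∫ ω, (W b ω - W a ω) * (W d ω - W c ω) ∂P = P[(W b - W a) * (W d - W c)] := rfl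
  rw [hprod, ← key, covariance_sub_left (hL b) (hL a) ((hL d).sub (hL c)),
    covariance_sub_right (hL b) (hL d) (hL c), covariance_sub_right (hL a) (hL d) (hL c)]
  simp only [hW.covariance_eval, NNReal.coe_min]
  exact min_sub_min_eq_volume_inter (by exact_mod_cast hab) (by exact_mod_cast hcd)

lemma memLp_sum_increment (hW : IsPreBrownianReal W P) {ι : Type*} [Fintype ι]
    (c : ι → ℝ) (l r : ι → ℝ≥0) :
    MemLp (fun ω => ∑ i, c i * (W (r i) ω - W (l i) ω)) 2 P := by
  refine memLp_finsetSum _ fun i _ => ?_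
  exact (((hW.isGaussianProcess.hasGaussianLaw_eval _).memLp_two).sub
    ((hW.isGaussianProcess.hasGaussianLaw_eval _).memLp_two)).const_mul _

lemma memLp_sum_indicator {ι : Type*} [Fintype ι] (c : ι → ℝ) (l r : ι → ℝ≥0) (T : ℝ≥0) :
    MemLp (fun s => ∑ i, (Set.Ioc (l i : ℝ) (r i : ℝ)).indicator (fun _ => c i) s) 2
      (volume.restrict (Set.Ioc (0 : ℝ) T)) := by
  refine memLp_finsetSum _ fun i _ => ?_
  exact (memLp_const (c i)).indicator measurableSet_Ioc

lemma integral_sq_sum_increment (hW : IsPreBrownianReal W P) {ι : Type*} [Fintype ι]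
    (c : ι → ℝ) (l r : ι → ℝ≥0) (T : ℝ≥0) (hlr : ∀ i, l i ≤ r i) (hr : ∀ i, r i ≤ T) :
    ∫ ω, (∑ i, c i * (W (r i) ω - W (l i) ω)) ^ 2 ∂P
      = ∫ s in Set.Ioc (0 : ℝ) T,
        (∑ i, (Set.Ioc (l i : ℝ) (r i : ℝ)).indicator (fun _ => c i) s) ^ 2 := by
  have hL : ∀ i, MemLp (fun ω => c i * (W (r i) ω - W (l i) ω)) 2 P := fun i =>
    (((hW.isGaussianProcess.hasGaussianLaw_eval _).memLp_two).sub
    ((hW.isGaussianProcess.hasGaussianLaw_eval _).memLp_two)).const_mul _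
  have hR : ∀ i, MemLp ((Set.Ioc (l i : ℝ) (r i : ℝ)).indicator (fun _ => c i)) 2
      (volume.restrict (Set.Ioc (0 : ℝ) T)) := fun i =>
    (memLp_const (c i)).indicator measurableSet_Ioc
  have hLL : ∀ i j, Integrable (fun ω => c i * (W (r i) ω - W (l i) ω)
      * (c j * (W (r j) ω - W (l j) ω))) P := fun i j => (hL i).integrable_mul (hL j)
  have hRR : ∀ i j, Integrable (fun s => (Set.Ioc (l i : ℝ) (r i : ℝ)).indicator (fun _ => c i) s
      * (Set.Ioc (l j : ℝ) (r j : ℝ)).indicator (fun _ => c j) s)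
      (volume.restrict (Set.Ioc (0 : ℝ) T)) := fun i j => (hR i).integrable_mul (hR j)
  simp only [sq, Finset.sum_mul_sum]
  rw [integral_finsetSum _ fun i _ => integrable_finsetSum _ fun j _ => hLL i j,
    integral_finsetSum _ fun i _ => integrable_finsetSum _ fun j _ => hRR i j]
  refine Finset.sum_congr rfl fun i _ => ?_
  rw [integral_finsetSum _ fun j _ => hLL i j, integral_finsetSum _ fun j _ => hRR i j]
  refine Finset.sum_congr rfl fun j _ => ?_
  have e1 : ∀ ω, c i * (W (r i) ω - W (l i) ω) * (c j * (W (r j) ω - W (l j) ω))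
      = (c i * c j) * ((W (r i) ω - W (l i) ω) * (W (r j) ω - W (l j) ω)) := fun ω => by ring
  simp_rw [e1]
  rw [integral_const_mul, integral_increment_mul_increment hW (hlr i) (hlr j)]
  have e2 : ∀ s, (Set.Ioc (l i : ℝ) (r i : ℝ)).indicator (fun _ => c i) s
      * (Set.Ioc (l j : ℝ) (r j : ℝ)).indicator (fun _ => c j) s
      = (Set.Ioc (l i : ℝ) (r i : ℝ) ∩ Set.Ioc (l j : ℝ) (r j : ℝ)).indicator
        (fun _ => c i * c j) s := fun s => by
    rw [Set.inter_indicator_mul]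
  simp_rw [e2]
  rw [setIntegral_indicator (measurableSet_Ioc.inter measurableSet_Ioc), setIntegral_const,
    smul_eq_mul, mul_comm]
  congr 2
  symm
  apply Set.inter_eq_right.mpr
  rintro s ⟨hs, -⟩
  exact ⟨(NNReal.coe_nonneg _).trans_lt hs.1, hs.2.trans (by exact_mod_cast hr i)⟩

lemma eLpNorm_two_eq_of_integral_sq_eq {α β : Type*} [MeasurableSpace α] [MeasurableSpace β]
    {μ : Measure α} {ν : Measure β} {f : α → ℝ} {g : β → ℝ} (hf : MemLp f 2 μ) (hg : MemLp g 2 ν)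
    (h : ∫ x, f x ^ 2 ∂μ = ∫ x, g x ^ 2 ∂ν) : eLpNorm f 2 μ = eLpNorm g 2 ν := by
  rw [hf.eLpNorm_eq_integral_rpow_norm (by norm_num) (by norm_num),
    hg.eLpNorm_eq_integral_rpow_norm (by norm_num) (by norm_num)]
  simp [h]

lemma StepFun.eLpNorm_sub_integral (hW : IsPreBrownianReal W P) {T : ℝ≥0} (φ ψ : StepFun T) :
    eLpNorm (fun ω => φ.integral W ω - ψ.integral W ω) 2 P
      = eLpNorm (fun s => φ.toFun s - ψ.toFun s) 2 (volume.restrict (Set.Ioc (0 : ℝ) T)) := by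
  -- The difference of two step functions is one step function over the disjoint union of the index
  -- sets, so the isometry for a single family applies.
  set c : Fin φ.size ⊕ Fin ψ.size → ℝ := Sum.elim φ.coeff (fun i => -ψ.coeff i) with hc
  set l : Fin φ.size ⊕ Fin ψ.size → ℝ≥0 := Sum.elim φ.left ψ.left with hl
  set r : Fin φ.size ⊕ Fin ψ.size → ℝ≥0 := Sum.elim φ.right ψ.right with hr
  have e1 : (fun ω => φ.integral W ω - ψ.integral W ω)
      = fun ω => ∑ i, c i * (W (r i) ω - W (l i) ω) := by
    ext ω
    simp [StepFun.integral, Fintype.sum_sum_type, hc, hl, hr, sub_eq_add_neg,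
      Finset.sum_neg_distrib]
  have e2 : (fun s => φ.toFun s - ψ.toFun s)
      = fun s => ∑ i, (Set.Ioc (l i : ℝ) (r i : ℝ)).indicator (fun _ => c i) s := by
    ext s
    simp only [StepFun.toFun, Fintype.sum_sum_type, hc, hl, hr, sub_eq_add_neg,
      ← Finset.sum_neg_distrib, Sum.elim_inl, Sum.elim_inr]
    congr 1
    refine Finset.sum_congr rfl fun i _ => ?_
    simp only [Set.indicator_apply]
    split_ifs <;> simp
  rw [e1, e2]
  refine eLpNorm_two_eq_of_integral_sq_eq (memLp_sum_increment hW c l r)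
    (memLp_sum_indicator c l r T) (integral_sq_sum_increment hW c l r T ?_ ?_)
  · rintro (i | i)
    exacts [φ.left_le_right i, ψ.left_le_right i]
  · rintro (i | i)
    exacts [φ.right_le i, ψ.right_le i]

/-- The `L²` contraction property of the Wiener integral, for differences. -/
lemma IsWienerIntegral.eLpNorm_integral_sub_le (hW : IsPreBrownianReal W P) {T : ℝ≥0} {f g : ℝ → ℝ}
    {I J : Ω → ℝ} (hI : IsWienerIntegral P W T f I) (hJ : IsWienerIntegral P W T g J) :
    eLpNorm (fun ω => I ω - J ω) 2 P
      ≤ eLpNorm (fun s => f s - g s) 2 (volume.restrict (Set.Ioc (0 : ℝ) T)) := by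
  obtain ⟨φ, hφ, hφI⟩ := hI.exists_approx
  obtain ⟨ψ, hψ, hψJ⟩ := hJ.exists_approx
  have mI : ∀ χ : StepFun T, MemLp (χ.integral W) 2 P := fun χ => memLp_sum_increment hW _ _ _
  have mS : ∀ χ : StepFun T, MemLp χ.toFun 2 (volume.restrict (Set.Ioc (0 : ℝ) T)) := fun χ =>
    memLp_sum_indicator _ _ _ _
  -- Four approximation errors tend to 0 and the constant remains; the triangle inequalities `b1`
  -- and `b2` bound the left side by this sum for every `k`.
  have hlim := ((((hφI.add hψJ).add hφ).add hψ).add_const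
    (eLpNorm (fun s => f s - g s) 2 (volume.restrict (Set.Ioc (0 : ℝ) T))))
  simp only [add_zero, zero_add] at hlim
  refine ge_of_tendsto' hlim fun k => ?_
  have a1 : MemLp (fun ω => I ω - (φ k).integral W ω) 2 P := hI.memLp.sub (mI _)
  have a2 : MemLp (fun ω => J ω - (ψ k).integral W ω) 2 P := hJ.memLp.sub (mI _)
  have a3 : MemLp (fun s => f s - (φ k).toFun s) 2 (volume.restrict (Set.Ioc (0 : ℝ) T)) :=
    hI.memLp_integrand.sub (mS _)
  have a4 : MemLp (fun s => g s - (ψ k).toFun s) 2 (volume.restrict (Set.Ioc (0 : ℝ) T)) :=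
    hJ.memLp_integrand.sub (mS _)
  have a5 : MemLp (fun ω => (φ k).integral W ω - (ψ k).integral W ω) 2 P := (mI _).sub (mI _)
  have a6 : MemLp (fun s => f s - g s) 2 (volume.restrict (Set.Ioc (0 : ℝ) T)) :=
    hI.memLp_integrand.sub hJ.memLp_integrand
  have b1 : eLpNorm (fun ω => I ω - J ω) 2 P
      ≤ eLpNorm (fun ω => I ω - (φ k).integral W ω) 2 P
        + eLpNorm (fun ω => J ω - (ψ k).integral W ω) 2 P
        + eLpNorm (fun ω => (φ k).integral W ω - (ψ k).integral W ω) 2 P := by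
    have e : (fun ω => I ω - J ω) = ((fun ω => I ω - (φ k).integral W ω)
        - (fun ω => J ω - (ψ k).integral W ω))
        + (fun ω => (φ k).integral W ω - (ψ k).integral W ω) := by
      ext ω; simp only [Pi.add_apply, Pi.sub_apply]; ring
    rw [e]
    refine (eLpNorm_add_le (a1.sub a2).1 a5.1 (by norm_num)).trans ?_
    gcongr
    exact eLpNorm_sub_le a1.1 a2.1 (by norm_num)
  have b2 : eLpNorm (fun s => (φ k).toFun s - (ψ k).toFun s) 2
        (volume.restrict (Set.Ioc (0 : ℝ) T))
      ≤ eLpNorm (fun s => f s - (φ k).toFun s) 2 (volume.restrict (Set.Ioc (0 : ℝ) T))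
        + eLpNorm (fun s => g s - (ψ k).toFun s) 2 (volume.restrict (Set.Ioc (0 : ℝ) T))
        + eLpNorm (fun s => f s - g s) 2 (volume.restrict (Set.Ioc (0 : ℝ) T)) := by
    have e : (fun s => (φ k).toFun s - (ψ k).toFun s) = ((fun s => g s - (ψ k).toFun s)
        - (fun s => f s - (φ k).toFun s)) + (fun s => f s - g s) := by
      ext s; simp only [Pi.add_apply, Pi.sub_apply]; ring
    rw [e]
    refine (eLpNorm_add_le (a4.sub a3).1 a6.1 (by norm_num)).trans ?_
    gcongr
    rw [add_comm]
    exact eLpNorm_sub_le a4.1 a3.1 (by norm_num)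
  rw [StepFun.eLpNorm_sub_integral hW] at b1
  refine b1.trans ?_
  calc _ ≤ _ := add_le_add_right b2 _
    _ = _ := by simp only [add_assoc]

end WienerIntegral

/-! ### Error of Gaussian quadrature for exponentials. -/

section GaussQuadrature

lemma exp_sub_sum_range_eq (z : ℝ) {k : ℕ} (hk : k ≠ 0) :
    ∃ y ∈ Set.uIcc 0 z, Real.exp z - ∑ j ∈ Finset.range k, z ^ j / (j.factorial : ℝ)
      = Real.exp y * z ^ k / (k.factorial : ℝ) := by
  obtain ⟨n, rfl⟩ := Nat.exists_eq_succ_of_ne_zero hk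
  rcases eq_or_ne 0 z with rfl | hz
  · refine ⟨0, by simp, ?_⟩
    simp [Finset.sum_range_succ']
  have hU : UniqueDiffOn ℝ (Set.uIcc 0 z) := uniqueDiffOn_Icc (by simpa using hz.symm)
  have hit : ∀ i, ∀ y ∈ Set.uIcc 0 z,
      iteratedDerivWithin i Real.exp (Set.uIcc 0 z) y = Real.exp y := fun i y hy => by
    rw [iteratedDerivWithin_eq_iteratedDeriv hU (Real.contDiff_exp.contDiffAt) hy,
      iteratedDeriv_eq_iterate, Real.iter_deriv_exp]
  obtain ⟨y, hy, h⟩ := taylor_mean_remainder_lagrange (f := Real.exp) (n := n) hz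
    Real.contDiff_exp.contDiffOn (by
      refine Real.differentiable_exp.differentiableOn.congr fun y hy => ?_
      exact hit n y (Set.uIoo_subset_uIcc_self hy))
  have hy' := Set.uIoo_subset_uIcc_self hy
  refine ⟨y, hy', ?_⟩
  rw [hit _ y hy'] at h
  simp only [sub_zero] at h
  rw [← Nat.succ_eq_add_one] at h
  rw [← h, taylor_within_apply]
  congr 1
  refine Finset.sum_congr rfl fun j _ => ?_
  rw [hit j 0 Set.left_mem_uIcc]
  simp [div_eq_inv_mul]

/-- The even Taylor remainder of `exp` is nonnegative and controlled by `max 1 (exp z)`. -/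
lemma exp_sub_sum_range_even_mem {m : ℕ} (hm : m ≠ 0) (z : ℝ) :
    Real.exp z - ∑ j ∈ Finset.range (2 * m), z ^ j / (j.factorial : ℝ) ∈
      Set.Icc 0 (max 1 (Real.exp z) * (z ^ (2 * m) / ((2 * m).factorial : ℝ))) := by
  obtain ⟨y, hy, h⟩ := exp_sub_sum_range_eq z (k := 2 * m) (by omega)
  have hz : 0 ≤ z ^ (2 * m) := (even_two_mul m).pow_nonneg z
  rw [h, mul_div_assoc]
  refine ⟨by positivity, ?_⟩
  gcongr
  rcases Set.mem_uIcc.mp hy with h | h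
  · exact le_max_of_le_right (Real.exp_le_exp.mpr h.2)
  · exact le_max_of_le_left (Real.exp_le_one_iff.mpr h.2)

variable {w : ℝ → ℝ} {a b : ℝ} {m : ℕ} {x v : Fin m → ℝ}

/-- The square of the `j`-th Lagrange basis polynomial has degree 2m-2, so the rule integrates it
exactly; it is 1 at node `j` and 0 at the others, which isolates `v j` as the integral of a
nonnegative function. -/
lemma IsGaussQuadrature.weight_nonneg (h : IsGaussQuadrature w a b m x v) (hab : a ≤ b)
    (hw : ∀ y ∈ Set.Icc a b, 0 ≤ w y) (j : Fin m) : 0 ≤ v j := by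
  have hdeg : (Lagrange.basis Finset.univ x j ^ 2).natDegree < 2 * m := by
    have h1 := Lagrange.degree_basis (s := Finset.univ) (v := x) (i := j)
      h.injective.injOn (Finset.mem_univ j)
    have h2 := Polynomial.natDegree_eq_of_degree_eq_some h1
    have hm : 0 < m := j.pos
    refine (Polynomial.natDegree_pow_le).trans_lt ?_
    rw [h2, Finset.card_univ, Fintype.card_fin]
    omega
  have key := h.exact_on _ hdeg
  rw [Finset.sum_eq_single j] at key
  · rw [Polynomial.eval_pow, Lagrange.eval_basis_self h.injective.injOn (Finset.mem_univ j),
      one_pow, mul_one] at key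
    rw [key]
    refine intervalIntegral.integral_nonneg hab fun y hy => ?_
    rw [Polynomial.eval_pow]
    exact mul_nonneg (sq_nonneg _) (hw y hy)
  · intro i _ hij
    rw [Polynomial.eval_pow, Lagrange.eval_basis_of_ne hij.symm (Finset.mem_univ i)]
    simp
  · simp

lemma IsGaussQuadrature.sum_weight (h : IsGaussQuadrature w a b m x v) (hm : m ≠ 0) :
    ∑ j, v j = ∫ y in a..b, w y := by
  have := h.exact_on 1 (by simp; omega)
  simpa using this

/-- A one-sided polynomial approximation of `f` controls the Gauss quadrature error. -/
lemma IsGaussQuadrature.abs_error_le (h : IsGaussQuadrature w a b m x v) (hm : m ≠ 0)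
    (hab : a ≤ b) (hw : ∀ y ∈ Set.Icc a b, 0 ≤ w y) (hwi : IntervalIntegrable w volume a b)
    {f : ℝ → ℝ} (hf : Continuous f) (p : Polynomial ℝ) (hp : p.natDegree < 2 * m) {M : ℝ}
    (hM : ∀ y ∈ Set.Icc a b, f y - p.eval y ∈ Set.Icc 0 M) :
    |(∫ y in a..b, f y * w y) - ∑ j, v j * f (x j)| ≤ M * ∫ y in a..b, w y := by
  have i1 : IntervalIntegrable (fun y => f y * w y) volume a b :=
    hwi.continuousOn_mul hf.continuousOn
  have i2 : IntervalIntegrable (fun y => p.eval y * w y) volume a b :=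
    hwi.continuousOn_mul p.continuous.continuousOn
  -- By exactness, `p` can be subtracted from `f` on both sides. The two remaining terms lie in the
  -- same interval [0, M ∫w], so their difference carries no factor 2.
  have e : (∫ y in a..b, f y * w y) - ∑ j, v j * f (x j)
      = (∫ y in a..b, (f y - p.eval y) * w y) - ∑ j, v j * (f (x j) - p.eval (x j)) := by
    simp only [sub_mul, mul_sub, Finset.sum_sub_distrib]
    rw [intervalIntegral.integral_sub i1 i2, h.exact_on p hp]
    ring
  have hv := h.weight_nonneg hab hw
  have b1 : 0 ≤ ∫ y in a..b, (f y - p.eval y) * w y :=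
    intervalIntegral.integral_nonneg hab fun y hy => mul_nonneg (hM y hy).1 (hw y hy)
  have b2 : ∫ y in a..b, (f y - p.eval y) * w y ≤ M * ∫ y in a..b, w y := by
    rw [← intervalIntegral.integral_const_mul]
    refine intervalIntegral.integral_mono_on hab (by simpa only [sub_mul] using i1.sub i2)
      (hwi.const_mul M) fun y hy => ?_
    exact mul_le_mul_of_nonneg_right (hM y hy).2 (hw y hy)
  have b3 : 0 ≤ ∑ j, v j * (f (x j) - p.eval (x j)) :=
    Finset.sum_nonneg fun j _ => mul_nonneg (hv j) (hM _ (h.mem_Icc j)).1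
  have b4 : ∑ j, v j * (f (x j) - p.eval (x j)) ≤ M * ∫ y in a..b, w y := by
    rw [← h.sum_weight hm, Finset.mul_sum]
    refine Finset.sum_le_sum fun j _ => ?_
    rw [mul_comm M]
    exact mul_le_mul_of_nonneg_left (hM _ (h.mem_Icc j)).2 (hv j)
  rw [e, abs_le]
  constructor <;> linarith

/-- The polynomial is the Taylor polynomial at the midpoint, which makes (b-a)/2 the relevant
radius. Its remainder has even order 2m, hence is nonnegative. Keeping the decay e^(-at) is what
later makes the L² norm small for large a. -/
lemma IsGaussQuadrature.abs_exp_error_le (h : IsGaussQuadrature w a b m x v) (hm : m ≠ 0)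
    (hab : a ≤ b) (hw : ∀ y ∈ Set.Icc a b, 0 ≤ w y) (hwi : IntervalIntegrable w volume a b)
    {t : ℝ} (ht : 0 ≤ t) :
    |(∫ y in a..b, Real.exp (-y * t) * w y) - ∑ j, v j * Real.exp (-(x j) * t)|
      ≤ ((t * ((b - a) / 2)) ^ (2 * m) / ((2 * m).factorial : ℝ) * Real.exp (-(a * t)))
        * ∫ y in a..b, w y := by
  set μ : ℝ := (a + b) / 2 with hμ
  set p : Polynomial ℝ := Polynomial.C (Real.exp (-(μ * t))) * ∑ j ∈ Finset.range (2 * m),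
    Polynomial.C (1 / (j.factorial : ℝ)) * (Polynomial.C (-t) * (Polynomial.X - Polynomial.C μ)) ^ j
    with hp
  have hpe : ∀ y, p.eval y = Real.exp (-(μ * t)) *
      ∑ j ∈ Finset.range (2 * m), (-t * (y - μ)) ^ j / (j.factorial : ℝ) := fun y => by
    simp only [hp, Polynomial.eval_mul, Polynomial.eval_C, Polynomial.eval_finsetSum,
      Polynomial.eval_pow, Polynomial.eval_sub, Polynomial.eval_X]
    congr 1
    refine Finset.sum_congr rfl fun j _ => ?_
    ring
  have hdeg : p.natDegree < 2 * m := by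
    refine (Polynomial.natDegree_C_mul_le _ _).trans_lt ?_
    refine (Polynomial.natDegree_sum_le_of_forall_le (n := 2 * m - 1) _ _ fun j hj => ?_).trans_lt
      (by omega)
    refine (Polynomial.natDegree_C_mul_le _ _).trans ?_
    refine Polynomial.natDegree_pow_le.trans ?_
    have h1 : (Polynomial.C (-t) * (Polynomial.X - Polynomial.C μ)).natDegree ≤ 1 :=
      (Polynomial.natDegree_C_mul_le _ _).trans (Polynomial.natDegree_X_sub_C_le μ)
    have h2 := Finset.mem_range.mp hj
    calc j * _ ≤ j * 1 := Nat.mul_le_mul_left _ h1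
      _ ≤ 2 * m - 1 := by omega
  refine h.abs_error_le hm hab hw hwi (by fun_prop) p hdeg fun y hy => ?_
  have e1 : Real.exp (-y * t) = Real.exp (-(μ * t)) * Real.exp (-t * (y - μ)) := by
    rw [← Real.exp_add]; congr 1; ring
  rw [hpe, e1, ← mul_sub]
  obtain ⟨r1, r2⟩ := exp_sub_sum_range_even_mem hm (-t * (y - μ))
  refine ⟨by positivity, (mul_le_mul_of_nonneg_left r2 (Real.exp_pos _).le).trans ?_⟩
  rw [← mul_assoc, mul_comm]
  have e2 : (-t * (y - μ)) ^ (2 * m) ≤ (t * ((b - a) / 2)) ^ (2 * m) := by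
    rw [← Even.pow_abs (even_two_mul m)]
    refine pow_le_pow_left₀ (abs_nonneg _) ?_ _
    rw [abs_mul, abs_neg, abs_of_nonneg ht]
    refine mul_le_mul_of_nonneg_left ?_ ht
    rw [abs_le, hμ]
    constructor <;> linarith [hy.1, hy.2]
  -- The left side is max(e^(-μt), e^(-yt)), and both μ and y are at least a.
  have e3 : Real.exp (-(μ * t)) * max 1 (Real.exp (-t * (y - μ))) ≤ Real.exp (-(a * t)) := by
    rw [mul_max_of_nonneg _ _ (Real.exp_pos _).le, mul_one, ← e1]
    refine max_le (Real.exp_le_exp.mpr ?_) (Real.exp_le_exp.mpr ?_)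
    · have : a ≤ μ := by rw [hμ]; linarith
      nlinarith
    · nlinarith [hy.1]
  gcongr

end GaussQuadrature

/-! ### The fractional weight and the error of the node 0. -/

lemma fracConst_pos {H : ℝ} (h0 : -(1 / 2) < H) (h1 : H < 1 / 2) : 0 < fracConst H := by
  unfold fracConst
  have := Real.Gamma_pos_of_pos (s := H + 1 / 2) (by linarith)
  have := Real.Gamma_pos_of_pos (s := 1 / 2 - H) (by linarith)
  positivity

/-- By Euler's reflection formula the constant equals sin(π(H+1/2))/π. -/
lemma fracConst_le (H : ℝ) : fracConst H ≤ 1 / Real.pi := by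
  have h := Real.Gamma_mul_Gamma_one_sub (H + 1 / 2)
  rw [show 1 - (H + 1 / 2) = 1 / 2 - H by ring] at h
  rw [fracConst, h, one_div_div]
  gcongr
  exact Real.sin_le_one _

lemma fracWeight_nonneg {H : ℝ} (h0 : -(1 / 2) < H) (h1 : H < 1 / 2) {x : ℝ} (hx : 0 ≤ x) :
    0 ≤ fracWeight H x :=
  mul_nonneg (fracConst_pos h0 h1).le (Real.rpow_nonneg hx _)

lemma intervalIntegrable_fracWeight {H : ℝ} (h1 : H < 1 / 2) (a b : ℝ) :
    IntervalIntegrable (fracWeight H) volume a b :=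
  (intervalIntegral.intervalIntegrable_rpow' (by linarith)).const_mul _

lemma integrableOn_fracWeight_mul_exp {H : ℝ} (h1 : H < 1 / 2) {t : ℝ} (ht : 0 < t) :
    IntegrableOn (fun x => Real.exp (-x * t) * fracWeight H x) (Set.Ioi 0) := by
  have h := integrableOn_rpow_mul_exp_neg_mul_rpow (s := -H - 1 / 2) (p := 1) (b := t)
    (by linarith) (by norm_num) ht
  refine IntegrableOn.congr_fun (h.const_mul (fracConst H)) (fun x hx => ?_) measurableSet_Ioi
  simp only [Real.rpow_one, fracWeight]
  rw [show -x * t = -t * x by ring]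
  ring

/-- The fractional kernel is the Laplace transform of the fractional weight. -/
lemma fracKernel_eq_integral {H : ℝ} (h1 : H < 1 / 2) {t : ℝ} (ht : 0 < t) :
    fracKernel H t = ∫ x in Set.Ioi 0, Real.exp (-x * t) * fracWeight H x := by
  have h := Real.integral_rpow_mul_exp_neg_mul_Ioi (a := 1 / 2 - H) (r := t) (by linarith) ht
  have e : ∀ x, Real.exp (-x * t) * fracWeight H x
      = fracConst H * (x ^ (1 / 2 - H - 1) * Real.exp (-(t * x))) := fun x => by
    rw [fracWeight, show -H - 1 / 2 = 1 / 2 - H - 1 by ring, show -x * t = -(t * x) by ring]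
    ring
  simp_rw [e]
  have hG := Real.Gamma_pos_of_pos (s := 1 / 2 - H) (by linarith)
  rw [integral_const_mul, h, fracConst, fracKernel, one_div t, Real.inv_rpow ht.le,
    ← Real.rpow_neg ht.le, show -(1 / 2 - H) = H - 1 / 2 by ring]
  generalize Real.Gamma (H + 1 / 2) = A
  generalize Real.Gamma (1 / 2 - H) = B at hG ⊢
  field_simp

lemma zeroWeight_eq_integral {H : ℝ} (h1 : H < 1 / 2) (ξ : ℝ) :
    zeroWeight H ξ = ∫ x in (0 : ℝ)..ξ, fracWeight H x := by
  simp only [fracWeight]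
  rw [intervalIntegral.integral_const_mul, integral_rpow (Or.inl (by linarith)), zeroWeight,
    show -H - 1 / 2 + 1 = 1 / 2 - H by ring, Real.zero_rpow (by linarith)]
  ring

/-- Replacing `exp (-x t)` by `1` on `[0, ξ]`. -/
lemma abs_integral_sub_zeroWeight_le {H : ℝ} (h0 : -(1 / 2) < H) (h1 : H < 1 / 2) {ξ t : ℝ}
    (hξ : 0 ≤ ξ) (ht : 0 ≤ t) :
    |(∫ x in (0 : ℝ)..ξ, Real.exp (-x * t) * fracWeight H x) - zeroWeight H ξ|
      ≤ fracConst H / (3 / 2 - H) * ξ ^ (3 / 2 - H) * t := by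
  have i1 : IntervalIntegrable (fun x => Real.exp (-x * t) * fracWeight H x) volume 0 ξ :=
    (intervalIntegrable_fracWeight h1 0 ξ).continuousOn_mul (by fun_prop)
  rw [zeroWeight_eq_integral h1, ← intervalIntegral.integral_sub i1
    (intervalIntegrable_fracWeight h1 0 ξ), ← Real.norm_eq_abs]
  have hI : ∫ x in (0 : ℝ)..ξ, t * (fracConst H * x ^ (1 / 2 - H))
      = fracConst H / (3 / 2 - H) * ξ ^ (3 / 2 - H) * t := by
    rw [intervalIntegral.integral_const_mul, intervalIntegral.integral_const_mul,
      integral_rpow (Or.inl (by linarith)), show 1 / 2 - H + 1 = 3 / 2 - H by ring,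
      Real.zero_rpow (by linarith)]
    ring
  rw [← hI]
  refine intervalIntegral.norm_integral_le_of_norm_le hξ (ae_of_all _ fun x hx => ?_)
    (((intervalIntegral.intervalIntegrable_rpow' (by linarith)).const_mul _).const_mul _)
  have hw := fracWeight_nonneg h0 h1 hx.1.le
  have hx1 : x ^ (1 / 2 - H) = x * x ^ (-H - 1 / 2) := by
    rw [show 1 / 2 - H = 1 + (-H - 1 / 2) by ring, Real.rpow_add hx.1, Real.rpow_one]
  have e1 : Real.exp (-x * t) ≤ 1 := Real.exp_le_one_iff.mpr (by nlinarith [hx.1])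
  have e2 := Real.add_one_le_exp (-x * t)
  rw [Real.norm_eq_abs, abs_of_nonpos (by nlinarith)]
  calc -(Real.exp (-x * t) * fracWeight H x - fracWeight H x)
      = (1 - Real.exp (-x * t)) * fracWeight H x := by ring
    _ ≤ (x * t) * fracWeight H x := by gcongr; linarith
    _ = t * (fracConst H * x ^ (1 / 2 - H)) := by rw [hx1, fracWeight]; ring

/-! ### Minkowski's inequality and the cut-off at ξₙ. -/

/-- Minkowski's integral inequality in `L²`, with a prescribed bound `Λ` for the norms. -/
lemma lintegral_lintegral_sq_le {α β : Type*} [MeasurableSpace α] [MeasurableSpace β]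
    {μ : Measure α} {ν : Measure β} [SFinite μ] [SFinite ν] {g : α → β → ℝ≥0∞}
    (hg : Measurable (Function.uncurry g)) {Λ : α → ℝ≥0∞} (hΛ : Measurable Λ)
    (hΛ0 : ∀ᵐ x ∂μ, Λ x ≠ 0) (hΛt : ∀ᵐ x ∂μ, Λ x ≠ ∞)
    (h : ∀ᵐ x ∂μ, ∫⁻ t, g x t ^ 2 ∂ν ≤ Λ x ^ 2) :
    ∫⁻ t, (∫⁻ x, g x t ∂μ) ^ 2 ∂ν ≤ (∫⁻ x, Λ x ∂μ) ^ 2 := by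
  have hs : ∀ y : ℝ≥0∞, (y ^ (1 / 2 : ℝ)) ^ (2 : ℝ) = y := fun y => by
    rw [← ENNReal.rpow_mul]; norm_num
  have hgx : ∀ t, Measurable fun x => g x t := fun t => hg.of_uncurry_right
  -- Cauchy–Schwarz for the factorization g = Λ^(1/2) · Λ^(-1/2) g. After Tonelli, the inner
  -- integral of Λ⁻¹ g² over t is at most Λ.
  have hcs : ∀ t, (∫⁻ x, g x t ∂μ) ^ 2 ≤ (∫⁻ x, Λ x ∂μ) * ∫⁻ x, (Λ x)⁻¹ * g x t ^ 2 ∂μ := by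
    intro t
    have h1 := ENNReal.lintegral_mul_le_Lp_mul_Lq μ Real.HolderConjugate.two_two
      (f := fun x => Λ x ^ (1 / 2 : ℝ)) (g := fun x => (Λ x)⁻¹ ^ (1 / 2 : ℝ) * g x t)
      (hΛ.pow_const _).aemeasurable ((hΛ.inv.pow_const _).mul (hgx t)).aemeasurable
    have h2 : ∫⁻ x, g x t ∂μ = ∫⁻ x, ((fun x => Λ x ^ (1 / 2 : ℝ))
        * fun x => (Λ x)⁻¹ ^ (1 / 2 : ℝ) * g x t) x ∂μ := by
      refine lintegral_congr_ae ?_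
      filter_upwards [hΛ0, hΛt] with x hx0 hxt
      rw [Pi.mul_apply, ← mul_assoc, ← ENNReal.mul_rpow_of_nonneg _ _ (by norm_num),
        ENNReal.mul_inv_cancel hx0 hxt, ENNReal.one_rpow, one_mul]
    rw [← h2] at h1
    have h3 : ∀ x, ((Λ x)⁻¹ ^ (1 / 2 : ℝ) * g x t) ^ (2 : ℝ) = (Λ x)⁻¹ * g x t ^ 2 := fun x => by
      rw [ENNReal.mul_rpow_of_nonneg _ _ (by norm_num), hs, ENNReal.rpow_two]
    simp only [hs, h3] at h1
    calc (∫⁻ x, g x t ∂μ) ^ 2 = (∫⁻ x, g x t ∂μ) ^ (2 : ℝ) := (ENNReal.rpow_two _).symm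
      _ ≤ _ := ENNReal.rpow_le_rpow h1 (by norm_num)
      _ = _ := by rw [ENNReal.mul_rpow_of_nonneg _ _ (by norm_num), hs, hs]
  calc ∫⁻ t, (∫⁻ x, g x t ∂μ) ^ 2 ∂ν
      ≤ ∫⁻ t, (∫⁻ x, Λ x ∂μ) * ∫⁻ x, (Λ x)⁻¹ * g x t ^ 2 ∂μ ∂ν := lintegral_mono hcs
    _ = (∫⁻ x, Λ x ∂μ) * ∫⁻ t, ∫⁻ x, (Λ x)⁻¹ * g x t ^ 2 ∂μ ∂ν := by
      refine lintegral_const_mul _ ?_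
      refine Measurable.lintegral_prod_left' (f := fun p : α × β => (Λ p.1)⁻¹ * g p.1 p.2 ^ 2) ?_
      exact (hΛ.inv.comp measurable_fst).mul (hg.pow_const 2)
    _ = (∫⁻ x, Λ x ∂μ) * ∫⁻ x, ∫⁻ t, (Λ x)⁻¹ * g x t ^ 2 ∂ν ∂μ := by
      rw [lintegral_lintegral_swap]
      refine Measurable.aemeasurable ?_
      exact (hΛ.inv.comp measurable_snd).mul ((hg.comp measurable_swap).pow_const 2)
    _ ≤ (∫⁻ x, Λ x ∂μ) * ∫⁻ x, Λ x ∂μ := by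
      gcongr 1
      refine lintegral_mono_ae ?_
      filter_upwards [hΛ0, hΛt, h] with x hx0 hxt hx
      rw [lintegral_const_mul _ ((hg.of_uncurry_left).pow_const 2)]
      calc (Λ x)⁻¹ * ∫⁻ t, g x t ^ 2 ∂ν ≤ (Λ x)⁻¹ * Λ x ^ 2 := by gcongr
        _ = Λ x := by rw [sq, ← mul_assoc, ENNReal.inv_mul_cancel hx0 hxt, one_mul]
    _ = _ := (sq _).symm

lemma lintegral_exp_neg_mul {r : ℝ} (hr : 0 < r) :
    ∫⁻ t in Set.Ioi (0 : ℝ), ENNReal.ofReal (Real.exp (-r * t)) = ENNReal.ofReal (1 / r) := by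
  rw [← ofReal_integral_eq_lintegral_ofReal (exp_neg_integrableOn_Ioi 0 hr)
    (ae_of_all _ fun _ => (Real.exp_pos _).le), integral_exp_mul_Ioi (by linarith) 0]
  simp

lemma eLpNorm_two_le_of_lintegral_sq_le {α : Type*} [MeasurableSpace α] {μ : Measure α}
    {f : α → ℝ} {C : ℝ≥0∞} (h : ∫⁻ x, ‖f x‖ₑ ^ 2 ∂μ ≤ C ^ 2) : eLpNorm f 2 μ ≤ C := by
  rw [eLpNorm_eq_lintegral_rpow_enorm_toReal (by norm_num) (by norm_num)]
  simp only [ENNReal.toReal_ofNat, ENNReal.rpow_two]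
  calc (∫⁻ x, ‖f x‖ₑ ^ 2 ∂μ) ^ (1 / 2 : ℝ) ≤ (C ^ 2) ^ (1 / 2 : ℝ) :=
        ENNReal.rpow_le_rpow h (by norm_num)
    _ = C := by rw [← ENNReal.rpow_two, ← ENNReal.rpow_mul]; norm_num

/-- The `L²` norm of the truncated part of the Laplace transform. -/
lemma eLpNorm_integral_Ioi_le {H : ℝ} (h0 : 0 < H) (h1 : H < 1 / 2) {ξ : ℝ} (hξ : 0 < ξ) :
    eLpNorm (fun t => ∫ x in Set.Ioi ξ, Real.exp (-x * t) * fracWeight H x) 2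
      (volume.restrict (Set.Ioc (0 : ℝ) 1))
      ≤ ENNReal.ofReal (fracConst H / (√2 * H) * ξ ^ (-H)) := by
  have hc := fracConst_pos (H := H) (by linarith) h1
  set g : ℝ → ℝ → ℝ≥0∞ := fun x t => ENNReal.ofReal (Real.exp (-x * t) * fracWeight H x) with hgdef
  -- This is w(x) times 1/√(2x), the norm of e^(-x·) in L²(0,∞).
  set Λ : ℝ → ℝ≥0∞ := fun x => ENNReal.ofReal (fracConst H / √2 * x ^ (-H - 1)) with hΛdef
  have hwm : Measurable (fracWeight H) := by unfold fracWeight; fun_prop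
  have hgm : Measurable (Function.uncurry g) := by
    refine ENNReal.measurable_ofReal.comp ?_
    exact (by fun_prop : Measurable fun p : ℝ × ℝ => Real.exp (-p.1 * p.2)).mul
      (hwm.comp measurable_fst)
  have hΛi : ∫⁻ x in Set.Ioi ξ, Λ x = ENNReal.ofReal (fracConst H / (√2 * H) * ξ ^ (-H)) := by
    rw [← ofReal_integral_eq_lintegral_ofReal]
    · rw [integral_const_mul, integral_Ioi_rpow_of_lt (by linarith) hξ]
      congr 1
      rw [show -H - 1 + 1 = -H by ring]
      field_simp
    · exact (integrableOn_Ioi_rpow_of_lt (by linarith) hξ).const_mul _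
    · filter_upwards [ae_restrict_mem measurableSet_Ioi] with x hx
      have : 0 ≤ x := hξ.le.trans (le_of_lt hx)
      positivity
  refine eLpNorm_two_le_of_lintegral_sq_le ?_
  rw [← hΛi]
  refine le_trans (lintegral_mono fun t => ?_) (lintegral_lintegral_sq_le
    (μ := volume.restrict (Set.Ioi ξ)) hgm (Λ := Λ) (by fun_prop) ?_ ?_ ?_)
  · refine pow_le_pow_left' ((enorm_integral_le_lintegral_enorm _).trans (le_of_eq ?_)) 2
    refine setLIntegral_congr_fun measurableSet_Ioi fun x hx => ?_
    have := fracWeight_nonneg (H := H) (by linarith) h1 (hξ.le.trans (le_of_lt hx))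
    exact Real.enorm_of_nonneg (by positivity)
  · filter_upwards [ae_restrict_mem measurableSet_Ioi] with x hx
    have : 0 < x := hξ.trans hx
    simp only [hΛdef, ne_eq, ENNReal.ofReal_eq_zero, not_le]
    positivity
  · exact ae_of_all _ fun _ => ENNReal.ofReal_ne_top
  · filter_upwards [ae_restrict_mem measurableSet_Ioi] with x hx
    have hx0 : 0 < x := hξ.trans hx
    have hw := fracWeight_nonneg (H := H) (by linarith) h1 hx0.le
    have e : ∀ t, g x t ^ 2
        = ENNReal.ofReal (fracWeight H x ^ 2) * ENNReal.ofReal (Real.exp (-(2 * x) * t)) := by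
      intro t
      rw [hgdef, ← ENNReal.ofReal_pow (by positivity), ← ENNReal.ofReal_mul (by positivity)]
      congr 1
      rw [mul_pow, ← Real.exp_nat_mul, mul_comm]
      congr 2
      push_cast
      ring
    simp_rw [e]
    rw [lintegral_const_mul _ (by fun_prop)]
    calc _ ≤ ENNReal.ofReal (fracWeight H x ^ 2)
          * ∫⁻ t in Set.Ioi (0 : ℝ), ENNReal.ofReal (Real.exp (-(2 * x) * t)) := by
          gcongr
          exact Set.Ioc_subset_Ioi_self
      _ = Λ x ^ 2 := by
        rw [lintegral_exp_neg_mul (by positivity), ← ENNReal.ofReal_mul (by positivity),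
          hΛdef, ← ENNReal.ofReal_pow (by positivity)]
        congr 1
        have e3 : (x ^ (-H - 1 / 2)) ^ 2 = (x ^ (-H - 1)) ^ 2 * x := by
          rw [← Real.rpow_natCast, ← Real.rpow_natCast, ← Real.rpow_mul hx0.le,
            ← Real.rpow_mul hx0.le]
          nth_rw 3 [← Real.rpow_one x]
          rw [← Real.rpow_add hx0]
          congr 1
          push_cast
          ring
        rw [fracWeight, mul_pow, e3, mul_pow, div_pow, Real.sq_sqrt (by norm_num)]
        field_simp

/-! ### L² norms of the local errors and their total mass. -/

/-- The sequence k^k e^(-k)/k! decreases, its consecutive ratio being (1+1/k)^k/e ≤ 1; the bound is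
its value at k = 2. -/
lemma pow_self_mul_exp_neg_div_factorial_le {k : ℕ} (hk : 2 ≤ k) :
    (k : ℝ) ^ k * Real.exp (-k) / (k.factorial : ℝ) ≤ 2 * Real.exp (-2) := by
  induction k, hk using Nat.le_induction with
  | base => norm_num [Nat.factorial]; linarith
  | succ k hk ih =>
    refine le_trans ?_ ih
    have hk0 : (0 : ℝ) < k := by positivity
    have h1 : (((k : ℝ) + 1) / k) ^ k ≤ Real.exp 1 := by
      have h2 : ((k : ℝ) + 1) / k ≤ Real.exp (1 / k) := by
        have := Real.add_one_le_exp (1 / (k : ℝ))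
        calc ((k : ℝ) + 1) / k = 1 / k + 1 := by field_simp; ring
          _ ≤ _ := this
      calc (((k : ℝ) + 1) / k) ^ k ≤ Real.exp (1 / k) ^ k :=
            pow_le_pow_left₀ (by positivity) h2 k
        _ = Real.exp 1 := by rw [← Real.exp_nat_mul]; congr 1; field_simp
    rw [div_pow, div_le_iff₀ (by positivity)] at h1
    have h3 : Real.exp (-((k : ℝ) + 1)) * Real.exp 1 = Real.exp (-k) := by
      rw [← Real.exp_add]; congr 1; ring
    rw [Nat.factorial_succ]
    push_cast
    rw [pow_succ, ← h3, div_le_div_iff₀ (by positivity) (by positivity)]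
    have := mul_le_mul_of_nonneg_left h1
      (by positivity : 0 ≤ Real.exp (-((k : ℝ) + 1)) * ((k : ℝ) + 1) * (k.factorial : ℝ))
    linarith

/-- For fixed k the maximum is at y = k, as y/k ≤ e^(y/k-1) shows. -/
lemma pow_mul_exp_neg_div_factorial_le {k : ℕ} (hk : 2 ≤ k) {y : ℝ} (hy : 0 ≤ y) :
    y ^ k / (k.factorial : ℝ) * Real.exp (-y) ≤ 2 * Real.exp (-2) := by
  refine le_trans ?_ (pow_self_mul_exp_neg_div_factorial_le hk)
  have hk0 : (0 : ℝ) < k := by positivity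
  have h1 : y / k ≤ Real.exp (y / k - 1) := by
    have := Real.add_one_le_exp (y / k - 1)
    linarith
  have h2 : (y / k) ^ k ≤ Real.exp (y - k) := by
    calc (y / k) ^ k ≤ Real.exp (y / k - 1) ^ k := pow_le_pow_left₀ (by positivity) h1 k
      _ = Real.exp (y - k) := by rw [← Real.exp_nat_mul]; congr 1; field_simp
  rw [div_pow, div_le_iff₀ (by positivity)] at h2
  rw [div_mul_eq_mul_div]
  gcongr ?_ / _
  calc y ^ k * Real.exp (-y) ≤ Real.exp (y - k) * (k : ℝ) ^ k * Real.exp (-y) := by gcongr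
    _ = (k : ℝ) ^ k * (Real.exp (y - k) * Real.exp (-y)) := by ring
    _ = _ := by rw [← Real.exp_add]; congr 2; ring

lemma lintegral_pow_mul_exp_neg (k : ℕ) {a : ℝ} (ha : 0 < a) :
    ∫⁻ t in Set.Ioi (0 : ℝ), ENNReal.ofReal ((a * t) ^ k / (k.factorial : ℝ) * Real.exp (-(a * t)))
      = ENNReal.ofReal (1 / a) := by
  have hG := Real.integral_rpow_mul_exp_neg_mul_Ioi (a := (k : ℝ) + 1) (r := a) (by positivity) ha
  have hI : IntegrableOn (fun t : ℝ => t ^ ((k : ℝ) + 1 - 1) * Real.exp (-(a * t)))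
      (Set.Ioi 0) := by
    have h := integrableOn_rpow_mul_exp_neg_mul_rpow (s := (k : ℝ) + 1 - 1) (p := 1) (b := a)
      (by have : (0 : ℝ) ≤ k := by positivity
          linarith) (by norm_num) ha
    simpa [Real.rpow_one] using h
  have e : ∀ t, (a * t) ^ k / (k.factorial : ℝ) * Real.exp (-(a * t))
      = a ^ k / (k.factorial : ℝ) * (t ^ ((k : ℝ) + 1 - 1) * Real.exp (-(a * t))) := fun t => by
    rw [add_sub_cancel_right, Real.rpow_natCast, mul_pow]; ring
  simp_rw [e]
  rw [← ofReal_integral_eq_lintegral_ofReal (hI.const_mul _), integral_const_mul, hG,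
    Real.Gamma_nat_eq_factorial]
  · congr 1
    rw [← Nat.cast_succ, Real.rpow_natCast, one_div, inv_pow, pow_succ]
    field_simp
  · filter_upwards [ae_restrict_mem measurableSet_Ioi] with t ht
    have : 0 < t := ht
    positivity

/-- The squared L² norm is at most sup times L¹ norm. The sup is at most S = 2e⁻² ≤ 1; the L¹ norm
is at most 1/a, from the mass of a Gamma density, and at most S on the unit interval. -/
lemma eLpNorm_pow_mul_exp_neg_le {k : ℕ} (hk : 2 ≤ k) {a : ℝ} (ha : 0 < a) :
    eLpNorm (fun t => (a * t) ^ k / (k.factorial : ℝ) * Real.exp (-(a * t))) 2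
      (volume.restrict (Set.Ioc (0 : ℝ) 1))
      ≤ ENNReal.ofReal (√(2 * Real.exp (-2)) * min 1 (a ^ (-1 / 2 : ℝ))) := by
  set S : ℝ := 2 * Real.exp (-2) with hS
  have hS0 : 0 < S := by positivity
  have hS1 : S ≤ 1 := by
    have := Real.add_one_le_exp (2 : ℝ)
    rw [hS, Real.exp_neg, ← div_eq_mul_inv, div_le_one (Real.exp_pos _)]
    linarith
  have hn : ∀ t ∈ Set.Ioc (0 : ℝ) 1,
      0 ≤ (a * t) ^ k / (k.factorial : ℝ) * Real.exp (-(a * t)) := fun t ht => by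
    have := ht.1
    positivity
  have hb : ∀ t ∈ Set.Ioc (0 : ℝ) 1,
      (a * t) ^ k / (k.factorial : ℝ) * Real.exp (-(a * t)) ≤ S := fun t ht =>
    pow_mul_exp_neg_div_factorial_le hk (mul_pos ha ht.1).le
  have h1 : ∀ t ∈ Set.Ioc (0 : ℝ) 1,
      ‖(a * t) ^ k / (k.factorial : ℝ) * Real.exp (-(a * t))‖ₑ ^ 2
        ≤ ENNReal.ofReal S * ENNReal.ofReal
          ((a * t) ^ k / (k.factorial : ℝ) * Real.exp (-(a * t))) := fun t ht => by
    rw [Real.enorm_of_nonneg (hn t ht), sq]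
    gcongr
    exact hb t ht
  have hm : ENNReal.ofReal (√S * min 1 (a ^ (-1 / 2 : ℝ))) ^ 2
      = ENNReal.ofReal (S * min 1 (1 / a)) := by
    rw [← ENNReal.ofReal_pow (by positivity), mul_pow, Real.sq_sqrt hS0.le]
    congr 2
    have h2 : (a ^ (-1 / 2 : ℝ)) ^ 2 = 1 / a := by
      rw [← Real.rpow_natCast, ← Real.rpow_mul ha.le]
      norm_num
      rw [Real.rpow_neg_one]
    rcases le_total 1 (a ^ (-1 / 2 : ℝ)) with h | h
    · rw [min_eq_left h, min_eq_left]
      · norm_num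
      · rw [← h2]; nlinarith
    · rw [min_eq_right h, min_eq_right, h2]
      rw [← h2]
      have := Real.rpow_nonneg ha.le (-1 / 2)
      nlinarith
  refine eLpNorm_two_le_of_lintegral_sq_le ?_
  rw [hm]
  have h3 := setLIntegral_mono' (μ := volume) measurableSet_Ioc h1
  rcases le_total 1 (1 / a) with h | h
  · rw [min_eq_left h, mul_one]
    refine h3.trans ?_
    calc _ ≤ ∫⁻ t in Set.Ioc (0 : ℝ) 1, ENNReal.ofReal S := by
          refine setLIntegral_mono' measurableSet_Ioc fun t ht => ?_
          rw [← ENNReal.ofReal_mul hS0.le]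
          refine ENNReal.ofReal_le_ofReal ?_
          have := hb t ht
          nlinarith
      _ = _ := by simp
  · rw [min_eq_right h, ENNReal.ofReal_mul hS0.le, ← lintegral_pow_mul_exp_neg k ha]
    refine h3.trans ?_
    rw [lintegral_const_mul _ (by fun_prop)]
    gcongr
    exact Set.Ioc_subset_Ioi_self

lemma eLpNorm_const_mul_id_le {C : ℝ} (hC : 0 ≤ C) :
    eLpNorm (fun t => C * t) 2 (volume.restrict (Set.Ioc (0 : ℝ) 1))
      ≤ ENNReal.ofReal (C / √3) := by
  refine eLpNorm_two_le_of_lintegral_sq_le ?_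
  rw [← ENNReal.ofReal_pow (by positivity)]
  have e : ∀ t, ‖C * t‖ₑ ^ 2 = ENNReal.ofReal (C ^ 2 * t ^ 2) := fun t => by
    rw [Real.enorm_eq_ofReal_abs, ← ENNReal.ofReal_pow (abs_nonneg _), sq_abs, mul_pow]
  simp_rw [e]
  rw [← ofReal_integral_eq_lintegral_ofReal]
  · rw [integral_const_mul, ← intervalIntegral.integral_of_le zero_le_one, integral_pow]
    refine ENNReal.ofReal_le_ofReal ?_
    rw [div_pow, Real.sq_sqrt (by norm_num)]
    norm_num
    linarith
  · exact (Continuous.integrableOn_Ioc (by fun_prop))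
  · exact ae_of_all _ fun t => by positivity

/-- The total mass of `w` against `min 1 (x ^ (-1/2))`. -/
lemma integral_fracWeight_mul_min_le {H : ℝ} (h0 : 0 < H) (h1 : H < 1 / 2) {a b : ℝ}
    (ha : 0 < a) (hab : a ≤ b) :
    ∫ x in a..b, fracWeight H x * min 1 (x ^ (-1 / 2 : ℝ))
      ≤ fracConst H * (1 / (1 / 2 - H) + 1 / H) := by
  have hc := (fracConst_pos (H := H) (by linarith) h1).le
  set f : ℝ → ℝ := fun x => fracWeight H x * min 1 (x ^ (-1 / 2 : ℝ)) with hf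
  have hfm : Measurable f := by
    have : Measurable (fracWeight H) := by unfold fracWeight; fun_prop
    exact this.mul (by fun_prop)
  have hw : ∀ x ∈ Set.Ioi (0 : ℝ), 0 ≤ fracWeight H x := fun x hx =>
    fracWeight_nonneg (by linarith) h1 (le_of_lt hx)
  have hn : ∀ x ∈ Set.Ioi (0 : ℝ), 0 ≤ f x := fun x hx =>
    mul_nonneg (hw x hx) (le_min zero_le_one (Real.rpow_nonneg (le_of_lt hx) _))
  -- The integral is split at 1: x^(-H-1/2) is integrable at 0 and x^(-H-1) at infinity.
  have b1 : ∀ x ∈ Set.Ioi (0 : ℝ), f x ≤ fracWeight H x := fun x hx =>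
    mul_le_of_le_one_right (hw x hx) (min_le_left _ _)
  have b2 : ∀ x ∈ Set.Ioi (0 : ℝ), f x ≤ fracConst H * x ^ (-H - 1) := fun x hx => by
    refine (mul_le_mul_of_nonneg_left (min_le_right _ _) (hw x hx)).trans (le_of_eq ?_)
    rw [fracWeight, mul_assoc, ← Real.rpow_add hx]
    congr 2
    ring
  have hI1 : IntegrableOn (fracWeight H) (Set.Ioc 0 1) :=
    (intervalIntegrable_iff_integrableOn_Ioc_of_le zero_le_one).mp
      (intervalIntegrable_fracWeight h1 0 1)
  have hI2 : IntegrableOn (fun x => fracConst H * x ^ (-H - 1)) (Set.Ioi 1) :=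
    (integrableOn_Ioi_rpow_of_lt (by linarith) one_pos).const_mul _
  have hf1 : IntegrableOn f (Set.Ioc 0 1) := by
    refine Integrable.mono' hI1 hfm.aestronglyMeasurable ?_
    filter_upwards [ae_restrict_mem measurableSet_Ioc] with x hx
    rw [Real.norm_of_nonneg (hn x hx.1)]
    exact b1 x hx.1
  have hf2 : IntegrableOn f (Set.Ioi 1) := by
    refine Integrable.mono' hI2 hfm.aestronglyMeasurable ?_
    filter_upwards [ae_restrict_mem measurableSet_Ioi] with x hx
    have hx0 : (0 : ℝ) < x := one_pos.trans hx
    rw [Real.norm_of_nonneg (hn x hx0)]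
    exact b2 x hx0
  have hu : Set.Ioc (0 : ℝ) 1 ∪ Set.Ioi 1 = Set.Ioi 0 := Set.Ioc_union_Ioi_eq_Ioi zero_le_one
  have hf0 : IntegrableOn f (Set.Ioi 0) := hu ▸ hf1.union hf2
  rw [intervalIntegral.integral_of_le hab]
  calc ∫ x in Set.Ioc a b, f x ≤ ∫ x in Set.Ioi 0, f x := by
        refine setIntegral_mono_set hf0 ?_ ?_
        · filter_upwards [ae_restrict_mem measurableSet_Ioi] with x hx using hn x hx
        · exact LE.le.eventuallyLE fun x hx => ha.trans hx.1
    _ = (∫ x in Set.Ioc 0 1, f x) + ∫ x in Set.Ioi 1, f x := by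
        rw [← hu, setIntegral_union (Set.Ioc_disjoint_Ioi le_rfl) measurableSet_Ioi hf1 hf2]
    _ ≤ (∫ x in Set.Ioc 0 1, fracWeight H x) + ∫ x in Set.Ioi 1, fracConst H * x ^ (-H - 1) := by
        refine add_le_add (setIntegral_mono_on hf1 hI1 measurableSet_Ioc fun x hx => b1 x hx.1)
          (setIntegral_mono_on hf2 hI2 measurableSet_Ioi fun x hx =>
            b2 x ((one_pos (α := ℝ)).trans hx))
    _ = fracConst H * (1 / (1 / 2 - H) + 1 / H) := by
        rw [← intervalIntegral.integral_of_le zero_le_one, ← zeroWeight_eq_integral h1, zeroWeight,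
          integral_const_mul, integral_Ioi_rpow_of_lt (by linarith) one_pos, Real.one_rpow,
          Real.one_rpow, show -H - 1 + 1 = -H by ring]
        rw [div_neg, neg_div, neg_neg]
        ring

/-! ### The three-part error of the approximating kernel. -/

section KernelError

variable {H ξ₀ ξₙ : ℝ} {m n : ℕ}

lemma geomPoint_eq (hξ₀ : 0 < ξ₀) (hξₙ : 0 < ξₙ) (n i : ℕ) :
    geomPoint ξ₀ ξₙ n i = ξ₀ * ((ξₙ / ξ₀) ^ (1 / (n : ℝ))) ^ i := by
  rw [geomPoint, ← Real.rpow_natCast, ← Real.rpow_mul (by positivity)]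
  congr 2
  ring

lemma geomPoint_zero (ξ₀ ξₙ : ℝ) (n : ℕ) : geomPoint ξ₀ ξₙ n 0 = ξ₀ := by
  simp [geomPoint]

lemma geomPoint_self (hξ₀ : 0 < ξ₀) (hn : n ≠ 0) : geomPoint ξ₀ ξₙ n n = ξₙ := by
  have : (n : ℝ) ≠ 0 := by exact_mod_cast hn
  rw [geomPoint, div_self this, Real.rpow_one]
  field_simp

/-- The weighted sum of the norms of the local errors. -/
lemma sum_integral_fracWeight_mul_min_le (h0 : 0 < H) (h1 : H < 1 / 2) (n : ℕ) {q : ℝ}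
    (hq : 1 ≤ q) {a : ℕ → ℝ} (ha : ∀ i, 0 < a i) (haq : ∀ i, a (i + 1) = q * a i) :
    ∑ i ∈ Finset.range n, (∫ x in a i..a (i + 1), fracWeight H x) * min 1 (a i ^ (-1 / 2 : ℝ))
      ≤ √q * (fracConst H * (1 / (1 / 2 - H) + 1 / H)) := by
  have hmono : ∀ i, a i ≤ a (i + 1) := fun i => by rw [haq]; nlinarith [ha i]
  have hcont : ∀ i j, ContinuousOn (fun x : ℝ => min 1 (x ^ (-1 / 2 : ℝ)))
      (Set.uIcc (a i) (a j)) := fun i j => by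
    refine (continuous_const.min continuous_id).comp_continuousOn
      (ContinuousOn.rpow_const continuousOn_id fun x hx => Or.inl ?_)
    rcases Set.mem_uIcc.mp hx with h | h
    exacts [((ha i).trans_le h.1).ne', ((ha j).trans_le h.1).ne']
  have hint : ∀ i j, IntervalIntegrable
      (fun x => fracWeight H x * min 1 (x ^ (-1 / 2 : ℝ))) volume (a i) (a j) := fun i j =>
    (intervalIntegrable_fracWeight h1 _ _).mul_continuousOn (hcont i j)
  calc _ ≤ ∑ i ∈ Finset.range n,
        √q * ∫ x in a i..a (i + 1), fracWeight H x * min 1 (x ^ (-1 / 2 : ℝ)) := by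
        refine Finset.sum_le_sum fun i _ => ?_
        rw [← intervalIntegral.integral_mul_const, ← intervalIntegral.integral_const_mul]
        refine intervalIntegral.integral_mono_on (hmono i)
          ((intervalIntegrable_fracWeight h1 _ _).mul_const _) ((hint i (i + 1)).const_mul _)
          fun x hx => ?_
        have hx0 : 0 < x := (ha i).trans_le hx.1
        have hw := fracWeight_nonneg (H := H) (by linarith) h1 hx0.le
        rw [mul_left_comm]
        refine mul_le_mul_of_nonneg_left ?_ hw
        have hs1 : 1 ≤ √q := Real.one_le_sqrt.mpr hq
        -- Since x ≤ q a_i, replacing the left endpoint by x costs at most √q; this turns the sum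
        -- into a lower Riemann-type bound by one integral.
        have hk : a i ^ (-1 / 2 : ℝ) ≤ √q * x ^ (-1 / 2 : ℝ) := by
          have e : √q * x ^ (-1 / 2 : ℝ) = (x / q) ^ (-1 / 2 : ℝ) := by
            rw [Real.div_rpow hx0.le (by linarith), Real.sqrt_eq_rpow,
              show (-1 / 2 : ℝ) = -(1 / 2) by norm_num, Real.rpow_neg (by linarith : 0 ≤ q),
              div_inv_eq_mul, mul_comm]
          rw [e]
          refine Real.rpow_le_rpow_of_nonpos (by positivity) ?_ (by norm_num)
          rw [div_le_iff₀ (by linarith), mul_comm, ← haq]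
          exact hx.2
        rw [mul_min_of_nonneg _ _ (by positivity), mul_one]
        exact min_le_min hs1 hk
    _ = √q * ∫ x in a 0..a n, fracWeight H x * min 1 (x ^ (-1 / 2 : ℝ)) := by
        rw [← Finset.mul_sum, intervalIntegral.sum_integral_adjacent_intervals
          fun i _ => hint i (i + 1)]
    _ ≤ _ := by
        gcongr
        exact integral_fracWeight_mul_min_le h0 h1 (ha 0) (monotone_nat_of_le_succ hmono n.zero_le)

/-- The `L²` error of the approximating kernel: the contribution of the node `0`, of the cut-off
at `ξₙ`, and of the Gaussian quadrature. -/
theorem eLpNorm_fracKernel_sub_approxKernel_le (h0 : 0 < H) (h1 : H < 1 / 2) (hm : m ≠ 0)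
    (hn : n ≠ 0) (hξ₀ : 0 < ξ₀) (hξ : ξ₀ ≤ ξₙ) {x v : Fin n → Fin m → ℝ}
    (hrule : IsGaussianRule H ξ₀ ξₙ m n x v) {q : ℝ} (hq : q = (ξₙ / ξ₀) ^ (1 / (n : ℝ))) :
    eLpNorm (fun t => fracKernel H t - approxKernel H ξ₀ x v t) 2
      (volume.restrict (Set.Ioc (0 : ℝ) 1))
      ≤ ENNReal.ofReal (fracConst H / (3 / 2 - H) * ξ₀ ^ (3 / 2 - H) / √3
        + fracConst H / (√2 * H) * ξₙ ^ (-H)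
        + ((q - 1) / 2) ^ (2 * m) * √(2 * Real.exp (-2))
          * (√q * (fracConst H * (1 / (1 / 2 - H) + 1 / H)))) := by
  have hξₙ : 0 < ξₙ := hξ₀.trans_le hξ
  have hc := (fracConst_pos (H := H) (by linarith) h1).le
  have hq1 : 1 ≤ q := hq ▸ Real.one_le_rpow ((one_le_div hξ₀).mpr hξ) (by positivity)
  set a : ℕ → ℝ := geomPoint ξ₀ ξₙ n with ha_def
  have ha_eq : ∀ i, a i = ξ₀ * q ^ i := fun i => by rw [ha_def, geomPoint_eq hξ₀ hξₙ, hq]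
  have ha : ∀ i, 0 < a i := fun i => by rw [ha_eq]; positivity
  have haq : ∀ i, a (i + 1) = q * a i := fun i => by rw [ha_eq, ha_eq, pow_succ]; ring
  have hmono : ∀ i, a i ≤ a (i + 1) := fun i => by rw [haq]; nlinarith [ha i]
  set w : ℕ → ℝ := fun i => ∫ y in a i..a (i + 1), fracWeight H y with hw_def
  have hw0 : ∀ i, 0 ≤ w i := fun i => intervalIntegral.integral_nonneg (hmono i) fun y hy =>
    fracWeight_nonneg (by linarith) h1 ((ha i).le.trans hy.1)
  set e₀ : ℝ → ℝ := fun t => fracConst H / (3 / 2 - H) * ξ₀ ^ (3 / 2 - H) * t with he₀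
  set e₁ : ℝ → ℝ := fun t => ∫ y in Set.Ioi ξₙ, Real.exp (-y * t) * fracWeight H y with he₁
  set g : ℕ → ℝ → ℝ := fun i t => ((q - 1) / 2) ^ (2 * m) * w i *
    ((a i * t) ^ (2 * m) / ((2 * m).factorial : ℝ) * Real.exp (-(a i * t))) with hg
  have hpt : ∀ t ∈ Set.Ioc (0 : ℝ) 1, ‖fracKernel H t - approxKernel H ξ₀ x v t‖
      ≤ (e₀ + e₁ + ∑ i ∈ Finset.range n, g i) t := by
    rintro t ⟨ht, -⟩
    set f : ℝ → ℝ := fun y => Real.exp (-y * t) * fracWeight H y with hf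
    have hfi := integrableOn_fracWeight_mul_exp h1 ht
    have hfint : ∀ b c, IntervalIntegrable f volume b c := fun b c =>
      (intervalIntegrable_fracWeight h1 b c).continuousOn_mul (by fun_prop)
    have hsplit : fracKernel H t = (∫ y in (0 : ℝ)..ξ₀, f y)
        + ∑ i : Fin n, (∫ y in a i..a (i + 1), f y) + ∫ y in Set.Ioi ξₙ, f y := by
      rw [fracKernel_eq_integral h1 ht, ← intervalIntegral.integral_interval_add_Ioi hfi
        (hfi.mono_set (Set.Ioi_subset_Ioi hξₙ.le)),
        ← intervalIntegral.integral_add_adjacent_intervals (hfint 0 ξ₀) (hfint ξ₀ ξₙ),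
        Finset.sum_range (fun i => ∫ y in a i..a (i + 1), f y) |>.symm,
        intervalIntegral.sum_integral_adjacent_intervals fun i _ => hfint _ _]
      simp only [ha_def, geomPoint_zero, geomPoint_self hξ₀ hn, hf]
    have hE := abs_integral_sub_zeroWeight_le (H := H) (by linarith) h1 hξ₀.le ht.le
    have hT : 0 ≤ ∫ y in Set.Ioi ξₙ, f y :=
      setIntegral_nonneg measurableSet_Ioi fun y hy => mul_nonneg (Real.exp_pos _).le
        (fracWeight_nonneg (by linarith) h1 (hξₙ.le.trans (le_of_lt hy)))
    have hQ : ∀ i : Fin n, |(∫ y in a i..a (i + 1), f y)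
        - ∑ j, v i j * Real.exp (-(x i j) * t)| ≤ g i t := fun i => by
      refine ((hrule i).abs_exp_error_le hm (hmono i) (fun y hy =>
        fracWeight_nonneg (by linarith) h1 ((ha i).le.trans hy.1))
        (intervalIntegrable_fracWeight h1 _ _) ht.le).trans (le_of_eq ?_)
      -- Geometric spacing gives every interval the same relative half-width (q-1)/2.
      have e : t * ((a (i + 1) - a i) / 2) = (q - 1) / 2 * (a i * t) := by rw [haq]; ring
      simp only [hg, hw_def]
      rw [← ha_def, e, mul_pow]
      ring
    rw [hsplit, approxKernel, Real.norm_eq_abs]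
    have hD : (∫ y in (0 : ℝ)..ξ₀, f y) + ∑ i : Fin n, (∫ y in a i..a (i + 1), f y)
        + (∫ y in Set.Ioi ξₙ, f y)
        - (zeroWeight H ξ₀ + ∑ i, ∑ j, v i j * Real.exp (-(x i j) * t))
        = ((∫ y in (0 : ℝ)..ξ₀, f y) - zeroWeight H ξ₀) + (∫ y in Set.Ioi ξₙ, f y)
          + ∑ i : Fin n, ((∫ y in a i..a (i + 1), f y)
            - ∑ j, v i j * Real.exp (-(x i j) * t)) := by
      rw [Finset.sum_sub_distrib]; ring
    rw [hD]
    refine (abs_add_le _ _).trans ?_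
    rw [Pi.add_apply, Finset.sum_apply, Finset.sum_range]
    refine add_le_add ((abs_add_le _ _).trans (add_le_add hE (abs_of_nonneg hT).le)) ?_
    exact (Finset.abs_sum_le_sum_abs _ _).trans (Finset.sum_le_sum fun i _ => hQ i)
  have m0 : AEStronglyMeasurable e₀ (volume.restrict (Set.Ioc (0 : ℝ) 1)) :=
    Continuous.aestronglyMeasurable (by fun_prop)
  have m1 : AEStronglyMeasurable e₁ (volume.restrict (Set.Ioc (0 : ℝ) 1)) := by
    refine StronglyMeasurable.aestronglyMeasurable ?_
    refine StronglyMeasurable.integral_prod_left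
      (f := fun y t => Real.exp (-y * t) * fracWeight H y) (Measurable.stronglyMeasurable ?_)
    have : Measurable (fracWeight H) := by unfold fracWeight; fun_prop
    exact (by fun_prop : Measurable fun p : ℝ × ℝ => Real.exp (-p.1 * p.2)).mul
      (this.comp measurable_fst)
  have mg : ∀ i, AEStronglyMeasurable (g i) (volume.restrict (Set.Ioc (0 : ℝ) 1)) := fun i =>
    Continuous.aestronglyMeasurable (by simp only [hg]; fun_prop)
  have hgn : ∀ i, eLpNorm (g i) 2 (volume.restrict (Set.Ioc (0 : ℝ) 1))
      ≤ ENNReal.ofReal (((q - 1) / 2) ^ (2 * m) * √(2 * Real.exp (-2))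
        * (w i * min 1 (a i ^ (-1 / 2 : ℝ)))) := fun i => by
    have hr : 0 ≤ ((q - 1) / 2) ^ (2 * m) := (even_two_mul m).pow_nonneg _
    have hrw := mul_nonneg hr (hw0 i)
    have hgi : g i = (((q - 1) / 2) ^ (2 * m) * w i) • fun t =>
        (a i * t) ^ (2 * m) / ((2 * m).factorial : ℝ) * Real.exp (-(a i * t)) := rfl
    rw [hgi, eLpNorm_const_smul, Real.enorm_of_nonneg hrw]
    refine (mul_le_mul_right (eLpNorm_pow_mul_exp_neg_le (by omega) (ha i)) _).trans ?_
    rw [← ENNReal.ofReal_mul hrw]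
    refine ENNReal.ofReal_le_ofReal (le_of_eq ?_)
    ring
  have hr : 0 ≤ ((q - 1) / 2) ^ (2 * m) := (even_two_mul m).pow_nonneg _
  have hmin : ∀ i, 0 ≤ min 1 (a i ^ (-1 / 2 : ℝ)) := fun i =>
    le_min zero_le_one (Real.rpow_nonneg (ha i).le _)
  calc _ ≤ eLpNorm (e₀ + e₁ + ∑ i ∈ Finset.range n, g i) 2
          (volume.restrict (Set.Ioc (0 : ℝ) 1)) := by
        refine eLpNorm_mono_ae_real ?_
        filter_upwards [ae_restrict_mem measurableSet_Ioc] with t ht using hpt t ht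
    _ ≤ eLpNorm e₀ 2 (volume.restrict (Set.Ioc (0 : ℝ) 1))
        + eLpNorm e₁ 2 (volume.restrict (Set.Ioc (0 : ℝ) 1))
        + ∑ i ∈ Finset.range n, eLpNorm (g i) 2 (volume.restrict (Set.Ioc (0 : ℝ) 1)) := by
        refine (eLpNorm_add_le (m0.add m1) (Finset.aestronglyMeasurable_sum _ fun i _ => mg i)
          (by norm_num)).trans ?_
        gcongr
        · exact eLpNorm_add_le m0 m1 (by norm_num)
        · exact eLpNorm_sum_le (fun i _ => mg i) (by norm_num)
    _ ≤ ENNReal.ofReal (fracConst H / (3 / 2 - H) * ξ₀ ^ (3 / 2 - H) / √3)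
        + ENNReal.ofReal (fracConst H / (√2 * H) * ξₙ ^ (-H))
        + ∑ i ∈ Finset.range n, ENNReal.ofReal (((q - 1) / 2) ^ (2 * m) * √(2 * Real.exp (-2))
          * (w i * min 1 (a i ^ (-1 / 2 : ℝ)))) := by
        have : 0 < 3 / 2 - H := by linarith
        gcongr
        · exact eLpNorm_const_mul_id_le (by positivity)
        · exact eLpNorm_integral_Ioi_le h0 h1 hξₙ
        · exact hgn _
    _ ≤ _ := by
        have : 0 < 3 / 2 - H := by linarith
        rw [← ENNReal.ofReal_sum_of_nonneg, ← Finset.mul_sum, ← ENNReal.ofReal_add,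
          ← ENNReal.ofReal_add]
        · refine ENNReal.ofReal_le_ofReal ?_
          gcongr
          exact sum_integral_fracWeight_mul_min_le h0 h1 n hq1 ha haq
        · positivity
        · exact mul_nonneg (mul_nonneg hr (Real.sqrt_nonneg _))
            (Finset.sum_nonneg fun i _ => mul_nonneg (hw0 i) (hmin i))
        · positivity
        · positivity
        · exact fun i _ => mul_nonneg (mul_nonneg hr (Real.sqrt_nonneg _))
            (mul_nonneg (hw0 i) (hmin i))

end KernelError

/-! ### Numerical estimates for the chosen parameters. -/

/-- A tangent line bound for the concave function `u ↦ log ((exp u - 1) / 2)` at `u = log R`. -/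
lemma exp_sub_one_div_two_le {R : ℝ} (hR : 1 < R) (u : ℝ) :
    (Real.exp u - 1) / 2
      ≤ Real.exp (R / (R - 1) * (u - Real.log R) + Real.log ((R - 1) / 2)) := by
  have hE : 0 < R - 1 := by linarith
  have hR0 : 0 < R := by linarith
  rw [Real.exp_add, Real.exp_log (by positivity)]
  have hx : Real.exp (R / (R - 1) * (u - Real.log R)) = (Real.exp u / R) ^ (R / (R - 1)) := by
    rw [← Real.exp_log hR0, ← Real.exp_sub, ← Real.exp_mul, Real.exp_log hR0, mul_comm]
  -- Bernoulli's inequality for the base e^u/R and the exponent R/(R-1) ≥ 1.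
  have hb := one_add_mul_self_le_rpow_one_add (s := Real.exp u / R - 1) (p := R / (R - 1))
    (by have : 0 < Real.exp u / R := by positivity
        linarith) (by rw [le_div_iff₀ hE]; linarith)
  rw [add_sub_cancel] at hb
  rw [hx]
  have h2 : 1 + R / (R - 1) * (Real.exp u / R - 1) = (Real.exp u - 1) / (R - 1) := by
    field_simp; ring
  rw [h2, div_le_iff₀ hE] at hb
  linarith

lemma quadratic_nonpos_of_endpoints {A B C lo hi x : ℝ} (hA : 0 ≤ A)
    (hlo : A * lo ^ 2 + B * lo + C ≤ 0) (hhi : A * hi ^ 2 + B * hi + C ≤ 0)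
    (h1 : lo ≤ x) (h2 : x ≤ hi) : A * x ^ 2 + B * x + C ≤ 0 := by
  rcases h1.eq_or_lt with rfl | h1'
  · exact hlo
  have hd : 0 < hi - lo := by linarith
  have e : (A * x ^ 2 + B * x + C) * (hi - lo) = (hi - x) * (A * lo ^ 2 + B * lo + C)
      + (x - lo) * (A * hi ^ 2 + B * hi + C) - A * ((x - lo) * (hi - x)) * (hi - lo) := by ring
  have p1 : (hi - x) * (A * lo ^ 2 + B * lo + C) ≤ 0 :=
    mul_nonpos_of_nonneg_of_nonpos (by linarith) hlo
  have p2 : (x - lo) * (A * hi ^ 2 + B * hi + C) ≤ 0 :=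
    mul_nonpos_of_nonneg_of_nonpos (by linarith) hhi
  have p3 : 0 ≤ A * ((x - lo) * (hi - x)) * (hi - lo) :=
    mul_nonneg (mul_nonneg hA (mul_nonneg (by linarith) (by linarith))) hd.le
  nlinarith

/-- The polynomial inequality behind the choice of `m`, for at least two nodes per interval. -/
lemma level_polynomial_nonpos {s m : ℝ} (hm : 2 ≤ m) (h : |m - 0.1306 * s| < 1) :
    (1 / 2 + 2 * m * (128 / 47)) * (m * (3.4833232 * s - 10.2615))
      - (2 * m * 2.48362 - (0.3251 * s - 0.6163)) * (s ^ 2 - m) ≤ 0 := by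
  obtain ⟨h1, h2⟩ := abs_lt.mp h
  have hs : 7.65 ≤ s := by linarith
  -- For fixed s the expression is a convex quadratic in m, so only the ends of the admissible range
  -- of m need checking. The lower end changes form near s = 3/0.1306 ≈ 22.97.
  have key := quadratic_nonpos_of_endpoints (x := m) (lo := max 2 (0.1306 * s - 1))
    (hi := 0.1306 * s + 1)
    (A := 2 * (128 / 47) * (3.4833232 * s - 10.2615) + 2 * 2.48362)
    (B := 1 / 2 * (3.4833232 * s - 10.2615) - 2 * 2.48362 * s ^ 2 - (0.3251 * s - 0.6163))
    (C := (0.3251 * s - 0.6163) * s ^ 2) (by linarith) ?_ ?_ (max_le hm (by linarith))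
    (by linarith)
  · linarith
  · rcases le_total 2 (0.1306 * s - 1) with h3 | h3
    · rw [max_eq_right h3]
      obtain ⟨t, ht, rfl⟩ : ∃ t, 0 ≤ t ∧ s = 22.97 + t :=
        ⟨s - 22.97, by linarith, by ring⟩
      have := pow_nonneg ht 2
      have := pow_nonneg ht 3
      norm_num at *
      ring_nf at *
      linarith
    · rw [max_eq_left h3]
      obtain ⟨t, ht, rfl⟩ : ∃ t, 0 ≤ t ∧ s = 7.65 + t :=
        ⟨s - 7.65, by linarith, by ring⟩
      have ht2 : t ≤ 15.33 := by linarith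
      have a1 : 0 ≤ t * (15.33 - t) := mul_nonneg ht (by linarith)
      have a2 : 0 ≤ t * (t * (15.33 - t)) := mul_nonneg ht a1
      norm_num at *
      ring_nf at *
      linarith
  · obtain ⟨t, ht, rfl⟩ : ∃ t, 0 ≤ t ∧ s = 7.65 + t :=
        ⟨s - 7.65, by linarith, by ring⟩
    have := pow_nonneg ht 2
    have := pow_nonneg ht 3
    norm_num at *
    ring_nf at *
    linarith

lemma log_47_div_162_le :
    Real.log (47 / 162) ≤ 3 * Real.log 5 - 4 * Real.log 2 - 3 * Real.log 3 + 1 / 375 := by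
  have h1 : Real.log (376 / 375) ≤ 1 / 375 := by
    have := Real.log_le_sub_one_of_pos (show (0 : ℝ) < 376 / 375 by norm_num)
    norm_num at this ⊢
    linarith
  have h2 : (47 / 162 : ℝ) = 5 ^ 3 / (2 ^ 4 * 3 ^ 3) * (376 / 375) := by norm_num
  rw [h2, Real.log_mul (by norm_num) (by norm_num), Real.log_div (by norm_num) (by norm_num),
    Real.log_mul (by norm_num) (by norm_num), Real.log_pow, Real.log_pow, Real.log_pow]
  push_cast
  linarith

/-- The tangent line at `128 / 81`, close to the optimal ratio of consecutive points. -/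
lemma exp_sub_one_div_two_le_of_level_ge_two (u : ℝ) :
    (Real.exp u - 1) / 2 ≤ Real.exp (128 / 47 * u - 2.48362) := by
  refine (exp_sub_one_div_two_le (R := 128 / 81) (by norm_num) u).trans
    (Real.exp_le_exp.mpr ?_)
  have h1 : Real.log (128 / 81) = 7 * Real.log 2 - 4 * Real.log 3 := by
    rw [show (128 / 81 : ℝ) = 2 ^ 7 / 3 ^ 4 by norm_num, Real.log_div (by norm_num) (by norm_num),
      Real.log_pow, Real.log_pow]
    push_cast; ring
  have h2 := log_47_div_162_le
  rw [show ((128 / 81 : ℝ) - 1) / 2 = 47 / 162 by norm_num, h1,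
    show (128 / 81 : ℝ) / (128 / 81 - 1) = 128 / 47 by norm_num]
  have := Real.log_two_gt_d9
  have := Real.log_two_lt_d9
  have := Real.log_three_gt_d9
  have := Real.log_three_lt_d9
  have := Real.log_five_lt_d9
  norm_num at *
  linarith

/-- Tangent at ratio 5/4, used for m = 1; the slope is R/(R-1) = 5 and 3.19515 rounds down 5
log(5/4) + log 8. -/
lemma exp_sub_one_div_two_le_of_level_one (u : ℝ) :
    (Real.exp u - 1) / 2 ≤ Real.exp (5 * u - 3.19515) := by
  refine (exp_sub_one_div_two_le (R := 5 / 4) (by norm_num) u).trans (Real.exp_le_exp.mpr ?_)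
  have h1 : Real.log (5 / 4) = Real.log 5 - 2 * Real.log 2 := by
    rw [show (5 / 4 : ℝ) = 5 / 2 ^ 2 by norm_num, Real.log_div (by norm_num) (by norm_num),
      Real.log_pow]
    push_cast; ring
  have h2 : Real.log (1 / 8) = -(3 * Real.log 2) := by
    rw [show (1 / 8 : ℝ) = (2 ^ 3)⁻¹ by norm_num, Real.log_inv, Real.log_pow]
    push_cast; ring
  rw [show ((5 / 4 : ℝ) - 1) / 2 = 1 / 8 by norm_num, h1, h2,
    show (5 / 4 : ℝ) / (5 / 4 - 1) = 5 by norm_num]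
  have := Real.log_two_gt_d9
  have := Real.log_two_lt_d9
  have := Real.log_five_gt_d9
  norm_num at *
  linarith

/-- The exponent inequality for one node per interval. -/
lemma level_one_exponent_nonpos {s : ℝ} (hs1 : 1 ≤ s) (hs2 : s ≤ 15.32) :
    10.5 * (3.4833232 * s - 3.4048 * Real.log s - 3.4012)
      + s ^ 2 * (-6.3663 + 0.3251 * s - 0.3178 * Real.log s) ≤ 0 := by
  have hs0 : 0 < s := by linarith
  have l2 := Real.log_two_gt_d9
  have l3 := Real.log_three_gt_d9
  -- The expression decreases in log s, so any lower bound may replace it: 1 - 1/s up to 3, then log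
  -- 3 and log 8, rounded down.
  have red : ∀ ℓ, ℓ ≤ Real.log s → 10.5 * (3.4833232 * s - 3.4048 * ℓ - 3.4012)
      + s ^ 2 * (-6.3663 + 0.3251 * s - 0.3178 * ℓ) ≤ 0 →
      10.5 * (3.4833232 * s - 3.4048 * Real.log s - 3.4012)
      + s ^ 2 * (-6.3663 + 0.3251 * s - 0.3178 * Real.log s) ≤ 0 := fun ℓ h1 h2 => by
    have := mul_le_mul_of_nonneg_left h1 (sq_nonneg s)
    norm_num at *
    linarith
  rcases le_total s 3 with h | h
  · have h1 := Real.one_sub_inv_le_log_of_pos hs0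
    refine red _ h1 ?_
    have hi : s * s⁻¹ = 1 := mul_inv_cancel₀ hs0.ne'
    have hi0 : 0 < s⁻¹ := by positivity
    refine nonpos_of_mul_nonpos_left (b := s) ?_ hs0
    obtain ⟨t, ht, rfl⟩ : ∃ t, 0 ≤ t ∧ s = 1 + t := ⟨s - 1, by linarith, by ring⟩
    have e : (10.5 * (3.4833232 * (1 + t) - 3.4048 * (1 - (1 + t)⁻¹) - 3.4012)
      + (1 + t) ^ 2 * (-6.3663 + 0.3251 * (1 + t) - 0.3178 * (1 - (1 + t)⁻¹))) * (1 + t)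
      = 10.5 * (3.4833232 * (1 + t) ^ 2 - 3.4048 * t - 3.4012 * (1 + t))
      + (1 + t) ^ 2 * ((-6.3663 + 0.3251 * (1 + t)) * (1 + t) - 0.3178 * t) := by
      field_simp; ring
    rw [e]
    have ht2 : t ≤ 2 := by linarith
    norm_num at *
    nlinarith [mul_nonneg ht (by linarith : 0 ≤ 2 - t), mul_nonneg (mul_nonneg ht ht)
      (by linarith : 0 ≤ 2 - t), sq_nonneg (t * (2 - t)), sq_nonneg (t - 1.8),
      sq_nonneg (t * (t - 1.8))]
  · rcases le_total s 8 with h' | h'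
    · refine red 1.098 ?_ ?_
      · have := Real.log_le_log (by norm_num) h
        norm_num at *
        linarith
      · norm_num at *
        nlinarith [mul_nonneg (by linarith : 0 ≤ s - 3) (by linarith : 0 ≤ 8 - s),
          mul_nonneg (by linarith : 0 ≤ s) (mul_nonneg (by linarith : 0 ≤ s - 3)
            (by linarith : 0 ≤ 8 - s)), sq_nonneg (s - 3.7)]
    · refine red 2.079 ?_ ?_
      · have h1 := Real.log_le_log (by norm_num) h'
        rw [show (8 : ℝ) = 2 ^ 3 by norm_num, Real.log_pow] at h1
        norm_num at *
        linarith
      · norm_num at *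
        nlinarith [mul_nonneg (by linarith : 0 ≤ s - 8) (by linarith : 0 ≤ 383 / 25 - s),
          mul_nonneg (by linarith : 0 ≤ s) (mul_nonneg (by linarith : 0 ≤ s - 8)
            (by linarith : 0 ≤ 383 / 25 - s))]

/-- The quadrature part of the error is of the same order as the truncation errors. -/
lemma level_exponent_le {N m n : ℕ} (hN : 1 ≤ N) (hm : 1 ≤ m) (hn : 1 ≤ n)
    (hmN : |(m : ℝ) - 0.1306 * √(N : ℝ)| < 1) (hnN : |(n : ℝ) - (N : ℝ) / (m : ℝ)| < 1)
    {Λ : ℝ} (h0 : 0 ≤ Λ)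
    (hΛ : Λ ≤ 3.4833232 * √(N : ℝ) - 3.4048 * Real.log √(N : ℝ) - 3.4012) :
    ((Real.exp (Λ / n) - 1) / 2) ^ (2 * m) * Real.exp (Λ / n / 2)
      ≤ Real.exp (-0.024 + (0.3178 * Real.log √(N : ℝ) - 0.3251 * √(N : ℝ))) := by
  have hN1 : (1 : ℝ) ≤ N := by exact_mod_cast hN
  have hn1 : (1 : ℝ) ≤ n := by exact_mod_cast hn
  have hm1 : (1 : ℝ) ≤ m := by exact_mod_cast hm
  have hs2 : √(N : ℝ) ^ 2 = N := Real.sq_sqrt (by linarith)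
  have hs1 : 1 ≤ √(N : ℝ) := Real.one_le_sqrt.mpr hN1
  set s : ℝ := √(N : ℝ) with hs
  set u : ℝ := Λ / n with hu
  have hu0 : 0 ≤ u := by positivity
  have hbase : 0 ≤ (Real.exp u - 1) / 2 := by
    have := Real.add_one_le_exp u
    linarith
  have hexp : ∀ b : ℝ, (Real.exp u - 1) / 2 ≤ Real.exp b → 2 * m * b + u / 2
      ≤ -0.024 + (0.3178 * Real.log s - 0.3251 * s) →
      ((Real.exp u - 1) / 2) ^ (2 * m) * Real.exp (u / 2)
        ≤ Real.exp (-0.024 + (0.3178 * Real.log s - 0.3251 * s)) := fun b hb1 hb2 => by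
    calc ((Real.exp u - 1) / 2) ^ (2 * m) * Real.exp (u / 2)
        ≤ Real.exp b ^ (2 * m) * Real.exp (u / 2) := by gcongr
      _ = Real.exp (2 * m * b + u / 2) := by
          rw [← Real.exp_nat_mul, ← Real.exp_add]
          push_cast
          ring_nf
      _ ≤ _ := Real.exp_le_exp.mpr hb2
  rcases hm.eq_or_lt with h1 | h2
  · subst h1
    have hnN' : n = N := by
      simp only [Nat.cast_one, div_one] at hnN
      have h3 : |(n : ℤ) - N| < 1 := by exact_mod_cast hnN
      have := Int.abs_lt_one_iff.mp h3
      omega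
    have hsu : s ≤ 15.32 := by
      have := (abs_lt.mp hmN).1
      linarith
    -- Here 10.5 = 2·5 + 1/2 collects the slope and the factor √q, and 6.3663 = 2·3.19515 - 0.024.
    have key := level_one_exponent_nonpos hs1 hsu
    refine hexp _ (exp_sub_one_div_two_le_of_level_one u) ?_
    have hus : u * s ^ 2 = Λ := by
      rw [hu, hs2, hnN']
      field_simp
    have hsp : 0 < s ^ 2 := by positivity
    have : (10.5 * u + (-6.3663 + 0.3251 * s - 0.3178 * Real.log s)) * s ^ 2 ≤ 0 := by
      have e : (10.5 * u + (-6.3663 + 0.3251 * s - 0.3178 * Real.log s)) * s ^ 2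
        = 10.5 * Λ + s ^ 2 * (-6.3663 + 0.3251 * s - 0.3178 * Real.log s) := by
        rw [← hus]; ring
      rw [e]
      linarith
    have := nonpos_of_mul_nonpos_left this hsp
    push_cast
    linarith
  · have hm2 : (2 : ℝ) ≤ m := by exact_mod_cast h2
    have key := level_polynomial_nonpos hm2 hmN
    obtain ⟨hm3, hm4⟩ := abs_lt.mp hmN
    have hs3 : 7.65 ≤ s := by linarith
    have hd : 0 < s ^ 2 - m := by nlinarith
    -- Rounded-down log 7.5. It produces 10.2615 ≈ 3.4012 + 3.4048·2.0149 and 0.6163 ≈ 0.3178·2.0149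
    -- - 0.024.
    have hl : 2.0149 ≤ Real.log s := by
      have h3 : Real.log (7.5 : ℝ) ≤ Real.log s :=
        Real.log_le_log (by norm_num) (by linarith)
      rw [show (7.5 : ℝ) = 3 * 5 / 2 by norm_num, Real.log_div (by norm_num) (by norm_num),
        Real.log_mul (by norm_num) (by norm_num)] at h3
      have := Real.log_two_lt_d9
      have := Real.log_three_gt_d9
      have := Real.log_five_gt_d9
      linarith
    have hΛ0 : Λ ≤ 3.4833232 * s - 10.2615 := by linarith
    -- Rounding n loses less than 1, so nm falls short of N by less than m.
    have hnm : s ^ 2 - m ≤ n * m := by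
      have h3 := (abs_lt.mp hnN).1
      have h4 : (N : ℝ) / m < n + 1 := by linarith
      rw [div_lt_iff₀ (by linarith)] at h4
      linarith
    refine hexp _ (exp_sub_one_div_two_le_of_level_ge_two u) ?_
    have hus : u * (s ^ 2 - m) ≤ m * (3.4833232 * s - 10.2615) := by
      calc u * (s ^ 2 - m) ≤ u * (n * m) := by gcongr
        _ = m * Λ := by rw [hu]; field_simp
        _ ≤ _ := by gcongr
    have h5 : (1 / 2 + 2 * m * (128 / 47)) * u
        - (2 * m * 2.48362 - (0.3251 * s - 0.6163)) ≤ 0 := by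
      refine nonpos_of_mul_nonpos_left (b := s ^ 2 - m) ?_ hd
      refine le_trans ?_ key
      rw [sub_mul, mul_assoc]
      gcongr
    linarith

lemma sqrt_two_mul_exp_neg_two_le : √(2 * Real.exp (-2)) ≤ 0.5203 := by
  rw [Real.sqrt_le_left (by norm_num), Real.exp_neg, show (2 : ℝ) = 1 + 1 by norm_num,
    Real.exp_add]
  have h := Real.exp_one_gt_d9
  rw [mul_inv_le_iff₀ (by positivity)]
  norm_num at *
  nlinarith

theorem error_constant_le {N m n : ℕ} (hN : 1 ≤ N) (hm : 1 ≤ m) (hn : 1 ≤ n)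
    (hmN : |(m : ℝ) - 0.1306 * √(N : ℝ)| < 1) (hnN : |(n : ℝ) - (N : ℝ) / (m : ℝ)| < 1)
    {A ξ₀ ξₙ : ℝ} (hA : A = √(1 / 0.1 + 1 / (3 / 2 - 0.1)))
    (hξ₀ : ξ₀ = 4.3679 * (N : ℝ) ^ (0.1135 : ℝ)
      * Real.exp (-(1.06418 / ((3 / 2 - 0.1) * A)) * √(N : ℝ)))
    (hξₙ : ξₙ = 0.1421 * (N : ℝ) ^ (-1.5889 : ℝ) * Real.exp (3.2511 * √(N : ℝ)))
    {q : ℝ} (hq : q = (ξₙ / ξ₀) ^ (1 / (n : ℝ))) :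
    0 < ξ₀ ∧ ξ₀ ≤ ξₙ ∧
      fracConst 0.1 / (3 / 2 - 0.1) * ξ₀ ^ (3 / 2 - 0.1 : ℝ) / √3
        + fracConst 0.1 / (√2 * 0.1) * ξₙ ^ (-0.1 : ℝ)
        + ((q - 1) / 2) ^ (2 * m) * √(2 * Real.exp (-2))
          * (√q * (fracConst 0.1 * (1 / (1 / 2 - 0.1) + 1 / 0.1)))
      ≤ 5.8 * Real.exp (0.3178 * Real.log √(N : ℝ) - 0.3251 * √(N : ℝ)) := by
  have hN1 : (1 : ℝ) ≤ N := by exact_mod_cast hN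
  have hN0 : (0 : ℝ) < N := by linarith
  have hs1 : 1 ≤ √(N : ℝ) := Real.one_le_sqrt.mpr hN1
  have hlN : Real.log N = 2 * Real.log √(N : ℝ) := by rw [Real.log_sqrt hN0.le]; ring
  have hlev := fun Λ => @level_exponent_le N m n hN hm hn hmN hnN Λ
  rw [Real.rpow_def_of_pos hN0, hlN] at hξ₀ hξₙ
  set s : ℝ := √(N : ℝ) with hs
  set ℓ : ℝ := Real.log s with hℓ
  have hℓ0 : 0 ≤ ℓ := Real.log_nonneg hs1
  have hℓ1 : ℓ ≤ s - 1 := Real.log_le_sub_one_of_pos (by linarith)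
  have hA1 : 3.273268 ≤ A := by rw [hA]; exact Real.le_sqrt_of_sq_le (by norm_num)
  have hA2 : A ≤ 3.2733 := by rw [hA, Real.sqrt_le_left (by norm_num)]; norm_num
  set κ : ℝ := 1.06418 / ((3 / 2 - 0.1) * A) with hκ
  have hAp : 0 < (3 / 2 - 0.1) * A := by linarith
  have hκ1 : κ ≤ 0.2322232 := by
    rw [hκ, div_le_iff₀ hAp]; linarith
  have hκ2 : 0.23222 ≤ κ := by
    rw [hκ, le_div_iff₀ hAp]; linarith
  set x₀ : ℝ := Real.log 4.3679 + 0.227 * ℓ - κ * s with hx₀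
  set xₙ : ℝ := Real.log 0.1421 - 3.1778 * ℓ + 3.2511 * s with hxₙ
  have e₀ : ξ₀ = Real.exp x₀ := by
    rw [hξ₀, hx₀, sub_eq_add_neg, Real.exp_add, Real.exp_add, Real.exp_log (by norm_num)]
    ring_nf
  have eₙ : ξₙ = Real.exp xₙ := by
    rw [hξₙ, hxₙ, sub_eq_add_neg, Real.exp_add, Real.exp_add, Real.exp_log (by norm_num)]
    ring_nf
  have l2 := Real.log_two_gt_d9
  have l2' := Real.log_two_lt_d9
  have l3 := Real.log_three_gt_d9
  have l3' := Real.log_three_lt_d9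
  have l5 := Real.log_five_gt_d9
  have l5' := Real.log_five_lt_d9
  -- The ratio 0.1421/4.3679 is compared with 1/30, whose logarithm is known.
  have hratio : Real.log 0.1421 - Real.log 4.3679
      = -(Real.log 2 + Real.log 3 + Real.log 5) + Real.log (42630 / 43679) := by
    rw [← Real.log_div (by norm_num) (by norm_num), ← Real.log_mul (by norm_num) (by norm_num),
      ← Real.log_mul (by norm_num) (by norm_num), ← Real.log_inv,
      ← Real.log_mul (by norm_num) (by norm_num)]
    norm_num
  have r1 := Real.log_le_sub_one_of_pos (show (0 : ℝ) < 42630 / 43679 by norm_num)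
  have r2 := Real.one_sub_inv_le_log_of_pos (show (0 : ℝ) < 42630 / 43679 by norm_num)
  have hΛ0 : 0 ≤ xₙ - x₀ := by
    have : 0.23222 * s ≤ κ * s := by gcongr
    rw [hxₙ, hx₀]
    linarith
  have hΛ1 : xₙ - x₀ ≤ 3.4833232 * s - 3.4048 * ℓ - 3.4012 := by
    have : κ * s ≤ 0.2322232 * s := by gcongr
    rw [hxₙ, hx₀]
    linarith
  have hq' : q = Real.exp ((xₙ - x₀) / n) := by
    rw [hq, e₀, eₙ, ← Real.exp_sub, ← Real.exp_mul]
    ring_nf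
  have hsq : √q = Real.exp ((xₙ - x₀) / n / 2) := by
    rw [hq', ← Real.exp_half]
  have hG := hlev (xₙ - x₀) hΛ0 hΛ1
  rw [← hsq, ← hq', Real.exp_add] at hG
  set B : ℝ := Real.exp (0.3178 * ℓ - 0.3251 * s) with hB
  have hB0 : 0 < B := Real.exp_pos _
  have hc0 : 0 < fracConst 0.1 := fracConst_pos (by norm_num) (by norm_num)
  have hc : fracConst 0.1 ≤ 0.31832 := by
    refine (fracConst_le _).trans ?_
    rw [div_le_iff₀ Real.pi_pos]
    have := Real.pi_gt_d4
    linarith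
  have h24 : Real.exp (-0.024) ≤ 0.977 := by
    rw [Real.exp_neg]
    refine inv_le_of_inv_le₀ (by norm_num) ?_
    have := Real.add_one_le_exp (0.024 : ℝ)
    linarith
  -- The exponents match: 1.4·0.227 = 0.3178 and 1.4 κ ≥ 0.3251.
  have t1 : ξ₀ ^ (3 / 2 - 0.1 : ℝ) ≤ 7.9 * B := by
    have h1 : 7 * Real.log 4.3679 ≤ 5 * Real.log 7.9 := by
      have := Real.log_le_log (by norm_num : (0 : ℝ) < 4.3679 ^ 7)
        (by norm_num : (4.3679 : ℝ) ^ 7 ≤ 7.9 ^ 5)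
      rw [Real.log_pow, Real.log_pow] at this
      exact_mod_cast this
    have h2 : 0.23222 * s ≤ κ * s := by gcongr
    rw [e₀, ← Real.exp_mul, hB, ← Real.exp_log (by norm_num : (0 : ℝ) < 7.9), ← Real.exp_add,
      Real.exp_le_exp, hx₀]
    linarith
  have t2 : ξₙ ^ (-0.1 : ℝ) ≤ 1.216 * B := by
    have h1 : -Real.log 0.1421 ≤ 10 * Real.log 1.216 := by
      have := Real.log_le_log (by norm_num : (0 : ℝ) < (0.1421)⁻¹)
        (by norm_num : (0.1421 : ℝ)⁻¹ ≤ 1.216 ^ 10)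
      rw [Real.log_pow, Real.log_inv] at this
      exact_mod_cast this
    rw [eₙ, ← Real.exp_mul, hB, ← Real.exp_log (by norm_num : (0 : ℝ) < 1.216), ← Real.exp_add,
      Real.exp_le_exp, hxₙ]
    linarith
  have s3 : 1.732 ≤ √3 := Real.le_sqrt_of_sq_le (by norm_num)
  have s2 : 1.4142 ≤ √2 := Real.le_sqrt_of_sq_le (by norm_num)
  have p₀ : 0 ≤ ξ₀ ^ (3 / 2 - 0.1 : ℝ) := Real.rpow_nonneg (e₀ ▸ (Real.exp_pos _).le) _
  have pₙ : 0 ≤ ξₙ ^ (-0.1 : ℝ) := Real.rpow_nonneg (eₙ ▸ (Real.exp_pos _).le) _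
  refine ⟨e₀ ▸ Real.exp_pos _, ?_, ?_⟩
  · rw [e₀, eₙ, Real.exp_le_exp]
    linarith
  have u1 : fracConst 0.1 / (3 / 2 - 0.1) * ξ₀ ^ (3 / 2 - 0.1 : ℝ) / √3 ≤ 1.038 * B := by
    have : (0 : ℝ) < 3 / 2 - 0.1 := by norm_num
    calc _ ≤ 0.31832 / (3 / 2 - 0.1) * (7.9 * B) / 1.732 := by gcongr
      _ = 0.31832 / (3 / 2 - 0.1) * 7.9 / 1.732 * B := by ring
      _ ≤ _ := by gcongr; norm_num
  have u2 : fracConst 0.1 / (√2 * 0.1) * ξₙ ^ (-0.1 : ℝ) ≤ 2.738 * B := by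
    calc _ ≤ 0.31832 / (1.4142 * 0.1) * (1.216 * B) := by gcongr
      _ ≤ _ := by linarith
  have hr : 0 ≤ ((q - 1) / 2) ^ (2 * m) := (even_two_mul m).pow_nonneg _
  have u3 : ((q - 1) / 2) ^ (2 * m) * √(2 * Real.exp (-2))
      * (√q * (fracConst 0.1 * (1 / (1 / 2 - 0.1) + 1 / 0.1))) ≤ 2.024 * B := by
    calc _ = (((q - 1) / 2) ^ (2 * m) * √q) * √(2 * Real.exp (-2))
          * (fracConst 0.1 * (1 / (1 / 2 - 0.1) + 1 / 0.1)) := by ring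
      _ ≤ (0.977 * B) * 0.5203 * (0.31832 * (1 / (1 / 2 - 0.1) + 1 / 0.1)) := by
          refine mul_le_mul (mul_le_mul (hG.trans (by gcongr)) sqrt_two_mul_exp_neg_two_le
            (Real.sqrt_nonneg _) (by positivity)) (by gcongr) ?_ (by positivity)
          exact mul_nonneg hc0.le (by norm_num)
      _ ≤ _ := by linarith
  linarith

/-! ### From L² norms to the second moment. -/

lemma integral_abs_sq_eq {α : Type*} [MeasurableSpace α] {μ : Measure α} {f : α → ℝ}
    (hf : MemLp f 2 μ) : ∫ x, |f x| ^ 2 ∂μ = (eLpNorm f 2 μ).toReal ^ 2 := by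
  have h0 : 0 ≤ ∫ x, |f x| ^ 2 ∂μ := integral_nonneg fun x => by positivity
  rw [hf.eLpNorm_eq_integral_rpow_norm (by norm_num) (by norm_num)]
  simp only [ENNReal.toReal_ofNat, Real.rpow_two, Real.norm_eq_abs]
  rw [ENNReal.toReal_ofReal (by positivity), ← Real.rpow_natCast, ← Real.rpow_mul h0]
  norm_num

lemma measurable_fracKernel (H : ℝ) : Measurable (fracKernel H) := by
  unfold fracKernel
  fun_prop

lemma continuous_approxKernel (H ξ₀ : ℝ) {m n : ℕ} (x v : Fin n → Fin m → ℝ) :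
    Continuous (approxKernel H ξ₀ x v) := by
  unfold approxKernel
  fun_prop

end MarkovApprox

theorem corollary3p1 {Ω : Type*} [MeasurableSpace Ω] (P : Measure Ω)
    (W : ℝ≥0 → Ω → ℝ) (hW : IsBrownianReal W P)
    (N m n : ℕ) (hN : 1 ≤ N) (hm : 1 ≤ m) (hn : 1 ≤ n)
    (hmN : |(m : ℝ) - 0.1306 * √(N : ℝ)| < 1)
    (hnN : |(n : ℝ) - (N : ℝ) / (m : ℝ)| < 1)
    (A ξ₀ ξₙ : ℝ)
    (hA : A = √(1 / 0.1 + 1 / (3 / 2 - 0.1)))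
    (hξ₀ : ξ₀ = 4.3679 * (N : ℝ) ^ (0.1135 : ℝ)
      * Real.exp (-(1.06418 / ((3 / 2 - 0.1) * A)) * √(N : ℝ)))
    (hξₙ : ξₙ = 0.1421 * (N : ℝ) ^ (-1.5889 : ℝ) * Real.exp (3.2511 * √(N : ℝ)))
    (x v : Fin n → Fin m → ℝ) (hrule : MarkovApprox.IsGaussianRule 0.1 ξ₀ ξₙ m n x v)
    (X Xhat : ℝ≥0 → Ω → ℝ)
    (hX : MarkovApprox.IsGaussianVolterra P W (MarkovApprox.fracKernel 0.1) X)
    (hXhat : MarkovApprox.IsGaussianVolterra P W (MarkovApprox.approxKernel 0.1 ξ₀ x v) Xhat) :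
    Integrable (fun ω => |X 1 ω - Xhat 1 ω| ^ 2) P ∧
    ∫ ω, |X 1 ω - Xhat 1 ω| ^ 2 ∂P ≤
      ∫ t in (0 : ℝ)..1,
        |MarkovApprox.fracKernel 0.1 t - MarkovApprox.approxKernel 0.1 ξ₀ x v t| ^ 2 ∧
    ∫ ω, |X 1 ω - Xhat 1 ω| ^ 2 ∂P ≤
      33.6483 * (N : ℝ) ^ (0.3178 : ℝ) * Real.exp (-0.6502 * √(N : ℝ)) := by
  obtain ⟨hpos, hle, hconst⟩ :=
    MarkovApprox.error_constant_le hN hm hn hmN hnN hA hξ₀ hξₙ rfl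
  have hker := (MarkovApprox.eLpNorm_fracKernel_sub_approxKernel_le (H := 0.1) (by norm_num)
    (by norm_num) (by omega) (by omega) hpos hle hrule rfl).trans
    (ENNReal.ofReal_le_ofReal hconst)
  set D : ℝ → ℝ := fun t => MarkovApprox.fracKernel 0.1 t - MarkovApprox.approxKernel 0.1 ξ₀ x v t
    with hD
  have hDm : MemLp D 2 (volume.restrict (Set.Ioc (0 : ℝ) 1)) :=
    ⟨((MarkovApprox.measurable_fracKernel _).sub
      (MarkovApprox.continuous_approxKernel _ _ x v).measurable).aestronglyMeasurable,
      hker.trans_lt ENNReal.ofReal_lt_top⟩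
  have h1 := hX 1
  have h2 := hXhat 1
  have hL : MemLp (fun ω => X 1 ω - Xhat 1 ω) 2 P := h1.memLp.sub h2.memLp
  have hR : MemLp (fun s : ℝ => D (((1 : ℝ≥0) : ℝ) - s)) 2
      (volume.restrict (Set.Ioc (0 : ℝ) ((1 : ℝ≥0) : ℝ))) :=
    h1.memLp_integrand.sub h2.memLp_integrand
  have hWL := MarkovApprox.IsWienerIntegral.eLpNorm_integral_sub_le hW.toIsPreBrownianReal h1 h2
  have hstab : ∫ ω, |X 1 ω - Xhat 1 ω| ^ 2 ∂P ≤ ∫ t in (0 : ℝ)..1, |D t| ^ 2 := by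
    -- The Wiener integrand is D(1 - s); reflecting the unit interval leaves the integral unchanged.
    have hrefl : ∫ t in (0 : ℝ)..1, |D t| ^ 2
        = ∫ s in Set.Ioc (0 : ℝ) ((1 : ℝ≥0) : ℝ), |D (((1 : ℝ≥0) : ℝ) - s)| ^ 2 := by
      rw [NNReal.coe_one, ← intervalIntegral.integral_of_le zero_le_one,
        intervalIntegral.integral_comp_sub_left (fun t => |D t| ^ 2) 1]
      norm_num
    rw [hrefl, MarkovApprox.integral_abs_sq_eq hL, MarkovApprox.integral_abs_sq_eq hR]
    exact pow_le_pow_left₀ ENNReal.toReal_nonneg (ENNReal.toReal_mono hR.2.ne hWL) 2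
  refine ⟨by simpa only [sq_abs] using hL.integrable_sq, hstab, hstab.trans ?_⟩
  rw [intervalIntegral.integral_of_le zero_le_one, MarkovApprox.integral_abs_sq_eq hDm]
  have hN0 : (0 : ℝ) < N := by exact_mod_cast hN
  calc (eLpNorm D 2 (volume.restrict (Set.Ioc (0 : ℝ) 1))).toReal ^ 2
      ≤ (5.8 * Real.exp (0.3178 * Real.log √(N : ℝ) - 0.3251 * √(N : ℝ))) ^ 2 := by
        refine pow_le_pow_left₀ ENNReal.toReal_nonneg ?_ 2
        exact ENNReal.toReal_le_of_le_ofReal (by positivity) hker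
    _ = 33.64 * (N : ℝ) ^ (0.3178 : ℝ) * Real.exp (-0.6502 * √(N : ℝ)) := by
        rw [mul_pow, ← Real.exp_nat_mul, Real.rpow_def_of_pos hN0, mul_assoc, ← Real.exp_add,
          Real.log_sqrt hN0.le]
        push_cast
        norm_num
        ring_nf
    _ ≤ _ := by
        gcongr
        norm_num
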